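/- All graphs and multigraphs are finite; graphs are simple, multigraphs may have loops and parallel edges. For a graph or multigraph $H$ write $|H|$ for its number of vertices and $\|H\|$ for its number of edges. Let $M$ be a connected multigraph (with at least one vertex) and let $G$ be a graph. An $M$-subdivision in $G$ is a subgraph of $G$ that is a copy of a graph obtained from $M$ by subdividing each edge $0$ or more times; it is maximum if no $M$-subdivision in $G$ has more edges. Let $\mathcal L(M,G)$ be the set of maximum $M$-subdivisions in $G$, and let $\tau(M,G)$ be the minimum size of a set $S\subseteq V(G)$ that meets the vertex set of every $Q\in\mathcal L(M,G)$. Suppose that $\mathcal L(M,G)$ is pairwise intersecting, that is, any two of its members have a common vertex. If $|G|>\|M\|^3$, then $$\tau(M,G)\le\max\{5|G|^{2/3},\,2\|M\|^2|G|^{1/3}\}.$$ In particular, if $|G|\ge\|M\|^6$, then $\tau(M,G)\le 5|G|^{2/3}$. Moreover (the case $M=K_2$), every connected graph $G$ on $n$ vertices has a set $S\subseteq V(G)$ with $|S|\le 5n^{2/3}$ such that every longest path of $G$ contains a vertex of $S$. -/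

import Mathlib

namespace MSub

variable {α β V : Type*}

/-- A multigraph (loops and parallel edges allowed) is connected if it has a vertex and any two of
its vertices are joined by a walk. -/
def IsConnected (M : Graph α β) : Prop :=
  M.vertexSet.Nonempty ∧
    ∀ x ∈ M.vertexSet, ∀ y ∈ M.vertexSet, Relation.ReflTransGen M.Adj x y

/-- A copy in the simple graph `G` of a graph obtained from the multigraph `M` by subdividing each
edge zero or more times. The vertices of `M` go to distinct branch vertices of `G`; each edge of
`M` is replaced by a path of `G` joining the branch vertices of its two ends (by a cycle through
the branch vertex if the edge is a loop); the replacements pass through no other branch vertices,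
and replacements of distinct edges share no edges and no vertices except branch vertices. -/
structure Subdivision (M : Graph α β) (G : SimpleGraph V) where
  /-- The branch vertices. -/
  branch : M.vertexSet → V
  branch_injective : Function.Injective branch
  /-- One end of each edge (a choice of orientation, used only to write down the walks). -/
  tail : M.edgeSet → M.vertexSet
  /-- The other end of each edge. -/
  head : M.edgeSet → M.vertexSet
  isLink : ∀ e : M.edgeSet, M.IsLink e (tail e) (head e)
  /-- The subdivided edge. -/
  route : ∀ e, G.Walk (branch (tail e)) (branch (head e))
  isPath_of_ne : ∀ e, tail e ≠ head e → (route e).IsPath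
  isCycle_of_eq : ∀ e (h : tail e = head e),
    ((route e).copy rfl (congrArg branch h.symm)).IsCycle
  branch_mem_route : ∀ e x, branch x ∈ (route e).support → x = tail e ∨ x = head e
  route_inter_route : ∀ e f, e ≠ f → ∀ v, v ∈ (route e).support → v ∈ (route f).support →
    v ∈ Set.range branch
  edges_disjoint : ∀ e f, e ≠ f → (route e).edges.Disjoint (route f).edges

/-- The subgraph of `G` formed by the branch vertices and the subdivided edges. -/
def Subdivision.toSubgraph {M : Graph α β} {G : SimpleGraph V} (D : Subdivision M G) :
    G.Subgraph :=
  (⨆ x, G.singletonSubgraph (D.branch x)) ⊔ ⨆ e, (D.route e).toSubgraph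

/-- The subgraph `Q` of `G` is an `M`-subdivision. -/
def IsSubdivision (M : Graph α β) {G : SimpleGraph V} (Q : G.Subgraph) : Prop :=
  ∃ D : Subdivision M G, D.toSubgraph = Q

/-- The family `𝓛(M, G)` of maximum `M`-subdivisions in `G`: those with the largest number of
edges among all `M`-subdivisions in `G`. -/
def maxSubdivisions (M : Graph α β) (G : SimpleGraph V) : Set G.Subgraph :=
  {Q | IsSubdivision M Q ∧
    ∀ R : G.Subgraph, IsSubdivision M R → R.edgeSet.ncard ≤ Q.edgeSet.ncard}

/-- Any two members of a family of subgraphs have a common vertex. -/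
def PairwiseIntersecting {G : SimpleGraph V} (L : Set G.Subgraph) : Prop :=
  ∀ Q ∈ L, ∀ R ∈ L, (Q.verts ∩ R.verts).Nonempty

/-- A transversal of a family of subgraphs: a vertex set that meets every member. -/
def IsTransversal {G : SimpleGraph V} (L : Set G.Subgraph) (S : Finset V) : Prop :=
  ∀ Q ∈ L, ∃ v ∈ S, v ∈ Q.verts

/-- `τ(M, G)`: the least size of a transversal of `𝓛(M, G)`. For finite `G` and for `M` with at
least one vertex, the set of all vertices of `G` is a transversal, so the minimum exists. -/
noncomputable def tau (M : Graph α β) (G : SimpleGraph V) : ℕ :=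
  sInf {k | ∃ S : Finset V, IsTransversal (maxSubdivisions M G) S ∧ S.card = k}

end MSub

/-!
The maximum subdivisions are connected and meet pairwise. If no small set met all of them, then by
Menger's theorem two disjoint paths inside them, both hard to block, would be joined by many
disjoint paths; two short ones among these close up to a cycle that is still hard to block but can
be avoided by some maximum subdivision `R`, so that many disjoint paths run from the cycle to `R`.
Two of them together with the longer arc of the cycle are a detour for `R`, and as `R` is maximum,
this detour is no longer than the segment it replaces. Hence the ends of these paths lie far apart
along every subdivided edge of `R`, and adding up the gaps shows that `R` has too many vertices.
A longest path is treated as a subdivision of a single edge.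
-/

namespace MSub

open SimpleGraph

section Walks

variable {V : Type*} {G : SimpleGraph V} {A B T : Set V} {u v : V}

lemma exists_append_first_mem (p : G.Walk u v) (h : ∃ t ∈ p.support, t ∈ T) :
    ∃ a ∈ T, ∃ (p₁ : G.Walk u a) (p₂ : G.Walk a v),
      p = p₁.append p₂ ∧ ∀ x ∈ p₁.support, x ∈ T → x = a := by
  induction p with
  | @nil u => exact ⟨u, by simpa using h, .nil, .nil, rfl, by simp⟩
  | @cons u w v hadj p ih =>
    by_cases hu : u ∈ T
    · exact ⟨u, hu, .nil, .cons hadj p, rfl, by simp⟩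
    obtain ⟨a, ha, p₁, p₂, rfl, hp⟩ := ih <| by
      obtain ⟨t, ht, htT⟩ := h
      rcases List.mem_cons.1 ht with rfl | ht
      exacts [absurd htT hu, ⟨t, ht, htT⟩]
    refine ⟨a, ha, .cons hadj p₁, p₂, rfl, fun x hx hxT => ?_⟩
    rcases List.mem_cons.1 hx with rfl | hx
    exacts [absurd hxT hu, hp x hx hxT]

lemma exists_prefix_path (p : G.Walk u v) (h : ∃ t ∈ p.support, t ∈ T) :
    ∃ a ∈ T, ∃ q : G.Walk u a,
      q.IsPath ∧ q.support ⊆ p.support ∧ ∀ x ∈ q.support, x ∈ T → x = a := by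
  classical
  obtain ⟨a, ha, p₁, p₂, rfl, hp⟩ := exists_append_first_mem p h
  exact ⟨a, ha, p₁.bypass, p₁.bypass_isPath,
    fun _ hx => Walk.support_subset_support_append_left _ _ (p₁.support_bypass_subset_support hx),
    fun x hx => hp x (p₁.support_bypass_subset_support hx)⟩

lemma exists_trimmed_path (p : G.Walk u v) (hA : ∃ t ∈ p.support, t ∈ A) (hv : v ∈ B) :
    ∃ a ∈ A, ∃ b ∈ B, ∃ q : G.Walk a b, q.IsPath ∧ q.support ⊆ p.support ∧
      (∀ x ∈ q.support, x ∈ A → x = a) ∧ ∀ x ∈ q.support, x ∈ B → x = b := by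
  obtain ⟨a, ha, q, -, hqp, hqA⟩ := exists_prefix_path p.reverse (by simpa using hA)
  obtain ⟨b, hb, r, hr, hrq, hrB⟩ := exists_prefix_path q.reverse ⟨v, by simp, hv⟩
  simp only [Walk.support_reverse] at hqp hrq
  refine ⟨a, ha, b, hb, r, hr, fun x hx => ?_, fun x hx => hqA x ?_, hrB⟩
  · simpa using hqp (List.mem_reverse.1 (hrq hx))
  · exact List.mem_reverse.1 (hrq hx)

lemma exists_walk_deleteEdges {e : Sym2 V} (p : G.Walk u v) (he : e ∉ p.edges) :
    ∃ q : (G.deleteEdges {e}).Walk u v, q.support = p.support :=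
  ⟨p.toDeleteEdge e he, by simp [Walk.toDeleteEdge]⟩

end Walks

section Separation

variable {V : Type*} {G H : SimpleGraph V} {A B S T : Set V} {u v x y : V}

/-- Every walk from `A` to `B` meets `S`. The sets need not be disjoint, so that `S` contains
`A ∩ B`. -/
def Separates (G : SimpleGraph V) (A B S : Set V) : Prop :=
  ∀ a ∈ A, ∀ b ∈ B, ∀ p : G.Walk a b, ∃ v ∈ p.support, v ∈ S

/-- The vertices of the components of `G - S` that meet `A`. -/
def reach (G : SimpleGraph V) (A S : Set V) : Set V :=
  {w | ∃ a ∈ A, ∃ p : G.Walk a w, ∀ v ∈ p.support, v ∉ S}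

lemma Separates.symm (h : Separates G A B S) : Separates G B A S := by
  intro b hb a ha p
  simpa using h a ha b hb p.reverse

lemma separates_right : Separates G A S S :=
  fun _ _ b hb p => ⟨b, p.end_mem_support, hb⟩

lemma mem_reach_of_walk (hu : u ∈ reach G A S) (p : G.Walk u v) (hp : ∀ w ∈ p.support, w ∉ S) :
    v ∈ reach G A S := by
  obtain ⟨a, ha, q, hq⟩ := hu
  refine ⟨a, ha, q.append p, fun w hw => ?_⟩
  exact ((Walk.mem_support_append_iff _ _).1 hw).elim (hq w) (hp w)

lemma mem_reach_of_mem (hu : u ∈ A) (hS : u ∉ S) : u ∈ reach G A S :=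
  ⟨u, hu, .nil, by simpa using hS⟩

lemma notMem_of_mem_reach (hu : u ∈ reach G A S) : u ∉ S :=
  let ⟨_, _, p, hp⟩ := hu
  hp u p.end_mem_support

lemma Separates.disjoint_reach (h : Separates G A B S) :
    Disjoint (reach G A S) (reach G B S) := by
  refine Set.disjoint_left.2 ?_
  rintro w ⟨a, ha, p, hp⟩ ⟨b, hb, q, hq⟩
  obtain ⟨v, hv, hvS⟩ := h a ha b hb (p.append q.reverse)
  rw [Walk.mem_support_append_iff, Walk.support_reverse, List.mem_reverse] at hv
  exact hv.elim (hp v · hvS) (hq v · hvS)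

lemma Separates.insert_of_deleteEdges (h : Separates (G.deleteEdges {s(x, y)}) A B S) :
    Separates G A B (insert x S) := by
  intro a ha b hb p
  by_cases hx : x ∈ p.support
  · exact ⟨x, hx, Or.inl rfl⟩
  obtain ⟨q, hq⟩ := exists_walk_deleteEdges p fun he => hx (p.fst_mem_support_of_mem_edges he)
  obtain ⟨v, hv, hvS⟩ := h a ha b hb q
  exact ⟨v, hq ▸ hv, Or.inr hvS⟩

lemma Separates.of_deleteEdges (hS : Separates (G.deleteEdges {s(x, y)}) A B S)
    (hy : y ∈ reach (G.deleteEdges {s(x, y)}) B S)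
    (hT : Separates (G.deleteEdges {s(x, y)}) A (insert x S) T) : Separates G A B T := by
  classical
  intro a ha b hb p
  obtain ⟨c, hc, q, hq, hqp, hqS⟩ :=
    exists_prefix_path p (hS.insert_of_deleteEdges a ha b hb p)
  suffices he : s(x, y) ∉ q.edges by
    obtain ⟨r, hr⟩ := exists_walk_deleteEdges q he
    obtain ⟨v, hv, hvT⟩ := hT a ha c hc r
    exact ⟨v, hqp (hr ▸ hv), hvT⟩
  intro he
  have hyq := q.snd_mem_support_of_mem_edges he
  obtain rfl := hqS x (q.fst_mem_support_of_mem_edges he) (Or.inl rfl)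
  have hx : x ∉ (q.takeUntil y hyq).support :=
    Walk.endpoint_notMem_support_takeUntil hq hyq (q.adj_of_mem_edges he).ne
  obtain ⟨r, hr⟩ := exists_walk_deleteEdges (q.takeUntil y hyq)
    fun he => hx (Walk.fst_mem_support_of_mem_edges _ he)
  refine Set.disjoint_left.1 hS.disjoint_reach ⟨a, ha, r, fun v hv hvS => ?_⟩ hy
  rw [hr] at hv
  exact hx (hqS v (q.support_takeUntil_subset_support hyq hv) (Or.inr hvS) ▸ hv)

lemma exists_mem_reach_deleteEdges {e : Sym2 V} (hS : Separates (G.deleteEdges {e}) A B S)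
    (h : ¬ Separates G A B S) : ∃ x ∈ e, x ∈ reach (G.deleteEdges {e}) A S := by
  unfold Separates at h
  push Not at h
  obtain ⟨a, ha, b, hb, p, hp⟩ := h
  have haR := mem_reach_of_mem (G := G.deleteEdges {e}) ha (hp a p.start_mem_support)
  have hbR := Set.disjoint_right.1 hS.disjoint_reach (mem_reach_of_mem hb (hp b p.end_mem_support))
  obtain ⟨d, hd, hfst, hsnd⟩ := p.exists_boundary_dart _ haR hbR
  refine ⟨d.fst, ?_, hfst⟩
  by_contra hne
  have hadj : (G.deleteEdges {e}).Adj d.fst d.snd := by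
    refine SimpleGraph.deleteEdges_adj.2 ⟨d.adj, fun he => hne ?_⟩
    exact Set.mem_singleton_iff.1 he ▸ Sym2.mem_mk_left _ _
  refine hsnd (mem_reach_of_walk hfst hadj.toWalk fun v hv => ?_)
  have : v = d.fst ∨ v = d.snd := by simpa using hv
  rcases this with rfl | rfl
  exacts [hp _ (p.dart_fst_mem_support_of_mem_darts hd),
    hp _ (p.dart_snd_mem_support_of_mem_darts hd)]

lemma exists_eq_mk_mem_reach_deleteEdges {e : Sym2 V}
    (hS : Separates (G.deleteEdges {e}) A B S) (h : ¬ Separates G A B S) :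
    ∃ x y, e = s(x, y) ∧ x ∈ reach (G.deleteEdges {e}) A S ∧
      y ∈ reach (G.deleteEdges {e}) B S := by
  obtain ⟨x, hxe, hx⟩ := exists_mem_reach_deleteEdges hS h
  obtain ⟨y, hye, hy⟩ := exists_mem_reach_deleteEdges hS.symm fun h' => h h'.symm
  exact ⟨x, y, (Sym2.mem_and_mem_iff (hS.disjoint_reach.ne_of_mem hx hy)).1 ⟨hxe, hye⟩, hx, hy⟩

end Separation

section Menger

variable {V ι κ : Type*} {G H : SimpleGraph V} {A B X Y S : Set V}

/-- A family of disjoint paths from `A` to `B` that meet `A` and `B` only in their ends. -/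
structure Linkage (G : SimpleGraph V) (A B : Set V) (ι : Type*) where
  /-- The ends in `A`. -/
  src : ι → V
  /-- The ends in `B`. -/
  tgt : ι → V
  /-- The paths. -/
  walk : ∀ i, G.Walk (src i) (tgt i)
  src_mem : ∀ i, src i ∈ A
  tgt_mem : ∀ i, tgt i ∈ B
  isPath : ∀ i, (walk i).IsPath
  eq_src : ∀ i, ∀ v ∈ (walk i).support, v ∈ A → v = src i
  eq_tgt : ∀ i, ∀ v ∈ (walk i).support, v ∈ B → v = tgt i
  disj : ∀ i j v, v ∈ (walk i).support → v ∈ (walk j).support → i = j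

namespace Linkage

/-- The linkage from `B` to `A` formed by the reversed paths. -/
def symm (L : Linkage G A B ι) : Linkage G B A ι where
  src := L.tgt
  tgt := L.src
  walk i := (L.walk i).reverse
  src_mem := L.tgt_mem
  tgt_mem := L.src_mem
  isPath i := (L.isPath i).reverse
  eq_src i v hv := L.eq_tgt i v (by simpa using hv)
  eq_tgt i v hv := L.eq_src i v (by simpa using hv)
  disj i j v hi hj := L.disj i j v (by simpa using hi) (by simpa using hj)

lemma src_injective (L : Linkage G A B ι) : Function.Injective L.src := fun i j h =>
  L.disj i j (L.src i) (Walk.start_mem_support _) (by rw [h]; exact Walk.start_mem_support _)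

lemma tgt_injective (L : Linkage G A B ι) : Function.Injective L.tgt :=
  L.symm.src_injective

lemma exists_src_eq [Fintype ι] {X : Finset V} (L : Linkage G X B ι)
    (hX : X.card ≤ Fintype.card ι) {x : V} (hx : x ∈ X) : ∃ i, L.src i = x := by
  obtain ⟨i, -, hi⟩ := Finset.surj_on_of_inj_on_of_card_le (s := Finset.univ) (t := X)
    (fun i _ => L.src i) (fun i _ => L.src_mem i) (fun _ _ _ _ h => L.src_injective h)
    (by simpa using hX) x hx
  exact ⟨i, hi.symm⟩

end Linkage

lemma nonempty_linkage {a b : ι → V} (p : ∀ i, G.Walk (a i) (b i))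
    (ha : ∀ i, a i ∈ A) (hb : ∀ i, b i ∈ B)
    (hd : ∀ i j v, v ∈ (p i).support → v ∈ (p j).support → i = j) :
    Nonempty (Linkage G A B ι) := by
  choose a' ha' b' hb' q hq hqp hqA hqB using fun i =>
    exists_trimmed_path (p i) ⟨a i, (p i).start_mem_support, ha i⟩ (hb i)
  exact ⟨⟨a', b', q, ha', hb', hq, hqA, hqB, fun i j v hi hj => hd i j v (hqp i hi) (hqp j hj)⟩⟩

namespace Linkage

lemma mono_graph (h : G ≤ H) (L : Linkage G A B ι) : Nonempty (Linkage H A B ι) :=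
  nonempty_linkage (fun i => (L.walk i).mapLe h) L.src_mem L.tgt_mem
    fun i j v hi hj => L.disj i j v (by simpa using hi) (by simpa using hj)

lemma exists_walk_src (L : Linkage G A B ι) {i : ι} {v : V} (hv : v ∈ (L.walk i).support) :
    ∃ p : G.Walk (L.src i) v, ∀ u ∈ p.support, u ∈ B → u = v := by
  classical
  refine ⟨(L.walk i).takeUntil v hv, fun u hu huB => ?_⟩
  obtain rfl := L.eq_tgt i u (Walk.support_takeUntil_subset_support _ hv hu) huB
  by_contra hne
  exact Walk.endpoint_notMem_support_takeUntil (L.isPath i) hv hne hu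

lemma mem_of_mem_support_of_separates (hS : Separates G A B S) (hX : S ⊆ X) (hY : S ⊆ Y)
    (L₁ : Linkage G A X ι) (L₂ : Linkage G Y B κ) {i : ι} {j : κ} {v : V}
    (hi : v ∈ (L₁.walk i).support) (hj : v ∈ (L₂.walk j).support) : v ∈ S := by
  obtain ⟨p, hp⟩ := L₁.exists_walk_src hi
  obtain ⟨q, hq⟩ := L₂.symm.exists_walk_src (v := v) (by simpa [symm] using hj)
  obtain ⟨u, hu, huS⟩ := hS _ (L₁.src_mem i) _ (L₂.symm.src_mem j) (p.append q.reverse)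
  rw [Walk.mem_support_append_iff, Walk.support_reverse, List.mem_reverse] at hu
  exact hu.elim (hp u · (hX huS) ▸ huS) (hq u · (hY huS) ▸ huS)

/-- The paths of `L₁` continue along those of `L₂` without running into each other, because the
two linkages can only meet in the separating set. -/
lemma exists_disjoint_walks (hS : Separates G A B S) (hX : S ⊆ X) (hY : S ⊆ Y)
    (L₁ : Linkage G A X ι) (L₂ : Linkage G Y B κ) (hGH : G ≤ H) {σ : ι → κ}
    (hσ : Function.Injective σ)
    (hjoin : ∀ i, L₁.tgt i = L₂.src (σ i) ∨ H.Adj (L₁.tgt i) (L₂.src (σ i)) ∧ L₁.tgt i ∉ S) :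
    ∃ p : ∀ i, H.Walk (L₁.src i) (L₂.tgt (σ i)),
      ∀ i j v, v ∈ (p i).support → v ∈ (p j).support → i = j := by
  have hglue : ∀ i, ∃ p : H.Walk (L₁.src i) (L₂.tgt (σ i)),
      ∀ v ∈ p.support, v ∈ (L₁.walk i).support ∨ v ∈ (L₂.walk (σ i)).support := by
    intro i
    obtain ⟨q, hq⟩ : ∃ q : H.Walk (L₁.tgt i) (L₂.src (σ i)),
        ∀ v ∈ q.support, v = L₁.tgt i ∨ v = L₂.src (σ i) := by
      rcases hjoin i with h | ⟨h, -⟩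
      exacts [⟨Walk.nil.copy rfl h, by simp⟩, ⟨h.toWalk, by simp⟩]
    refine ⟨((L₁.walk i).mapLe hGH).append (q.append ((L₂.walk (σ i)).mapLe hGH)), fun v hv => ?_⟩
    simp only [Walk.mem_support_append_iff, Walk.support_mapLe_eq_support] at hv
    rcases hv with hv | hv | hv
    · exact Or.inl hv
    · rcases hq v hv with rfl | rfl
      exacts [Or.inl (Walk.end_mem_support _), Or.inr (Walk.start_mem_support _)]
    · exact Or.inr hv
  choose p hp using hglue
  have hmix : ∀ i j v, v ∈ (L₁.walk i).support → v ∈ (L₂.walk (σ j)).support → i = j := by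
    intro i j v hi hj
    have hv := mem_of_mem_support_of_separates hS hX hY L₁ L₂ hi hj
    have htgt := L₁.eq_tgt i v hi (hX hv)
    have hsrc := L₂.eq_src (σ j) v hj (hY hv)
    have hi' := (hjoin i).resolve_right fun h => h.2 (htgt ▸ hv)
    exact hσ (L₂.src_injective (hi'.symm.trans (htgt.symm.trans hsrc)))
  refine ⟨p, fun i j v hi hj => ?_⟩
  rcases hp i v hi with hi | hi <;> rcases hp j v hj with hj | hj
  · exact L₁.disj i j v hi hj
  · exact hmix i j v hi hj
  · exact (hmix j i v hj hi).symm
  · exact hσ (L₂.disj _ _ v hi hj)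

end Linkage

lemma nonempty_linkage_bot [Finite V] {k : ℕ}
    (h : ∀ S : Finset V, Separates (⊥ : SimpleGraph V) A B S → k ≤ S.card) :
    Nonempty (Linkage (⊥ : SimpleGraph V) A B (Fin k)) := by
  classical
  cases nonempty_fintype V
  have hk := h (A ∩ B).toFinset fun a ha b hb p => by
    cases p with
    | nil => exact ⟨a, by simp, by simp [ha, hb]⟩
    | cons hadj _ => exact hadj.elim
  obtain ⟨f⟩ : Nonempty (Fin k ↪ (A ∩ B).toFinset) :=
    Function.Embedding.nonempty_of_card_le (by rwa [Fintype.card_fin, Fintype.card_coe])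
  have hf : ∀ i, (f i : V) ∈ A ∩ B := fun i => by simpa using (f i).2
  refine nonempty_linkage (fun i => .nil) (fun i => (hf i).1) (fun i => (hf i).2) ?_
  intro i j v hi hj
  simp only [Walk.support_nil, List.mem_singleton] at hi hj
  exact f.injective (Subtype.ext (hi.symm.trans hj))

lemma nonempty_linkage_of_deleteEdges [DecidableEq V] {k : ℕ} {x y : V} {S : Finset V}
    (hxy : G.Adj x y) (hx : x ∉ S) (hy : y ∉ S) (hk : S.card < k)
    (hS : Separates (G.deleteEdges {s(x, y)}) A B S)
    (L₁ : Linkage (G.deleteEdges {s(x, y)}) A (insert x S : Finset V) (Fin k))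
    (L₂ : Linkage (G.deleteEdges {s(x, y)}) (insert y S : Finset V) B (Fin k)) :
    Nonempty (Linkage G A B (Fin k)) := by
  have hjoin : ∀ i, ∃ j, L₁.tgt i = L₂.src j ∧ L₁.tgt i ∈ S ∨ L₁.tgt i = x ∧ L₂.src j = y := by
    intro i
    have hsrc {z : V} := L₂.exists_src_eq (x := z)
      (by rwa [Fintype.card_fin, Finset.card_insert_of_notMem hy])
    rcases Finset.mem_insert.1 (L₁.tgt_mem i) with hi | hi
    · obtain ⟨j, hj⟩ := hsrc (Finset.mem_insert_self y S)
      exact ⟨j, Or.inr ⟨hi, hj⟩⟩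
    · obtain ⟨j, hj⟩ := hsrc (Finset.mem_insert_of_mem hi)
      exact ⟨j, Or.inl ⟨hj.symm, hi⟩⟩
  choose σ hσ using hjoin
  have hσ_inj : Function.Injective σ := by
    intro i j hij
    apply L₁.tgt_injective
    rcases hσ i with ⟨hi, hiS⟩ | ⟨hi, hiy⟩ <;> rcases hσ j with ⟨hj, hjS⟩ | ⟨hj, hjy⟩
    · rw [hi, hj, hij]
    · exact absurd (hi ▸ hiS) (by rwa [hij, hjy])
    · exact absurd (hj ▸ hjS) (by rwa [← hij, hiy])
    · rw [hi, hj]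
  obtain ⟨p, hp⟩ := Linkage.exists_disjoint_walks hS (by simp) (by simp) L₁ L₂
    (deleteEdges_le _) hσ_inj fun i => (hσ i).imp And.left fun h => by
      rw [h.1, h.2]
      exact ⟨hxy, hx⟩
  exact nonempty_linkage p L₁.src_mem (fun i => L₂.tgt_mem _) hp

theorem menger [Finite V] {k : ℕ} (G : SimpleGraph V) (A B : Set V)
    (h : ∀ S : Finset V, Separates G A B S → k ≤ S.card) :
    Nonempty (Linkage G A B (Fin k)) := by
  classical
  induction hn : G.edgeSet.ncard using Nat.strong_induction_on generalizing G A B with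
  | _ n ih =>
  obtain rfl | hG := eq_or_ne G ⊥
  · exact nonempty_linkage_bot h
  obtain ⟨e, he⟩ := edgeSet_nonempty.2 hG
  have hlt : (G.deleteEdges {e}).edgeSet.ncard < n := by
    rw [← hn, edgeSet_deleteEdges]
    exact Set.ncard_sdiff_singleton_lt_of_mem he
  by_cases hk : ∀ S : Finset V, Separates (G.deleteEdges {e}) A B S → k ≤ S.card
  · obtain ⟨L⟩ := ih _ hlt _ A B hk rfl
    exact L.mono_graph (deleteEdges_le _)
  push Not at hk
  obtain ⟨S, hS, hSk⟩ := hk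
  obtain ⟨x, y, rfl, hx, hy⟩ :=
    exists_eq_mk_mem_reach_deleteEdges hS fun hS' => hSk.not_ge (h S hS')
  obtain ⟨L₁⟩ := ih _ hlt _ A (insert x S : Finset V) (fun T hT => h T <|
    hS.of_deleteEdges hy (by rwa [Finset.coe_insert] at hT)) rfl
  obtain ⟨L₂⟩ := ih _ hlt _ B (insert y S : Finset V) (fun T hT => h T <| by
    rw [Sym2.eq_swap] at hS hx hT
    exact (hS.symm.of_deleteEdges hx (by rwa [Finset.coe_insert] at hT)).symm) rfl
  exact nonempty_linkage_of_deleteEdges he (notMem_of_mem_reach hx) (notMem_of_mem_reach hy)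
    hSk hS L₁ L₂.symm

end Menger

section Bramble

variable {V : Type*} {G : SimpleGraph V} {F : Set (Set V)} {A D P Q R X Y Z W : Set V}

/-- `X` separates `Z` from every member of the family `F` that avoids `X`. -/
def Blocks (G : SimpleGraph V) (F : Set (Set V)) (X Z : Set V) : Prop :=
  ∀ Q ∈ F, Disjoint Q X → Separates G Z Q X

lemma blocks_self (Z : Set V) : Blocks G F Z Z :=
  fun _ _ _ => separates_right.symm

lemma Blocks.union (hX : Blocks G F X Z) (hY : Blocks G F Y W) :
    Blocks G F (X ∪ Y) (Z ∪ W) := by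
  intro Q hQ hd a ha b hb p
  rw [Set.disjoint_union_right] at hd
  rcases ha with ha | ha
  · exact (hX Q hQ hd.1 a ha b hb p).imp fun _ h => ⟨h.1, Or.inl h.2⟩
  · exact (hY Q hQ hd.2 a ha b hb p).imp fun _ h => ⟨h.1, Or.inr h.2⟩

lemma Blocks.disjoint (h : Blocks G F X Z) (hQ : Q ∈ F) (hd : Disjoint Q X) : Disjoint Z Q :=
  Set.disjoint_left.2 fun a ha haQ => by
    obtain ⟨v, hv, hvX⟩ := h Q hQ hd a ha a haQ .nil
    rw [Walk.support_nil, List.mem_singleton] at hv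
    exact Set.disjoint_left.1 hd haQ (hv ▸ hvX)

lemma Blocks.trans (hX : Blocks G F X Z) (hY : Blocks G F Y X) : Blocks G F Y Z := by
  classical
  intro Q hQ hd a ha b hb p
  obtain ⟨x, hx, hxX⟩ := hX Q hQ (hY.disjoint hQ hd).symm a ha b hb p
  obtain ⟨y, hy, hyY⟩ := hY Q hQ hd x hxX b hb (p.dropUntil x hx)
  exact ⟨y, p.support_dropUntil_subset_support hx hy, hyY⟩

/-- The least size of a set blocking `Z`. -/
noncomputable def blockingNumber (G : SimpleGraph V) (F : Set (Set V)) (Z : Set V) : ℕ :=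
  sInf {k | ∃ X : Finset V, Blocks G F X Z ∧ X.card = k}

lemma blockingNumber_le_card {X : Finset V} (h : Blocks G F X Z) :
    blockingNumber G F Z ≤ X.card :=
  Nat.sInf_le ⟨X, h, rfl⟩

lemma exists_blocks_card_eq [Finite V] (Z : Set V) :
    ∃ X : Finset V, Blocks G F X Z ∧ X.card = blockingNumber G F Z :=
  Nat.sInf_mem (s := {k | ∃ X : Finset V, Blocks G F X Z ∧ X.card = k})
    ⟨_, (Set.toFinite Z).toFinset, by simpa using blocks_self Z, rfl⟩

lemma Blocks.blockingNumber_le [Finite V] (h : Blocks G F X Z) :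
    blockingNumber G F Z ≤ blockingNumber G F X := by
  obtain ⟨Y, hY, hYc⟩ := exists_blocks_card_eq (G := G) (F := F) X
  exact hYc ▸ blockingNumber_le_card (h.trans hY)

lemma blockingNumber_empty : blockingNumber G F ∅ = 0 :=
  Nat.le_zero.1 (blockingNumber_le_card (X := ∅) (by simpa using blocks_self ∅))

lemma blockingNumber_singleton_le (v : V) : blockingNumber G F {v} ≤ 1 :=
  blockingNumber_le_card (X := {v}) (by simpa using blocks_self {v})

lemma blockingNumber_union_le [Finite V] (Z W : Set V) :
    blockingNumber G F (Z ∪ W) ≤ blockingNumber G F Z + blockingNumber G F W := by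
  classical
  obtain ⟨X, hX, hXc⟩ := exists_blocks_card_eq (G := G) (F := F) Z
  obtain ⟨Y, hY, hYc⟩ := exists_blocks_card_eq (G := G) (F := F) W
  calc blockingNumber G F (Z ∪ W)
      ≤ (X ∪ Y).card := blockingNumber_le_card (by rw [Finset.coe_union]; exact hX.union hY)
    _ ≤ X.card + Y.card := Finset.card_union_le X Y
    _ = blockingNumber G F Z + blockingNumber G F W := by rw [hXc, hYc]

lemma blockingNumber_biUnion_le [Finite V] {ι : Type*} {Z : ι → Set V} {b : ℕ} (s : Finset ι)
    (h : ∀ i ∈ s, blockingNumber G F (Z i) ≤ b) :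
    blockingNumber G F (⋃ i ∈ s, Z i) ≤ s.card * b := by
  classical
  induction s using Finset.induction_on with
  | empty => simp [blockingNumber_empty]
  | insert i s hi ih =>
    rw [Finset.set_biUnion_insert, Finset.card_insert_of_notMem hi, add_one_mul, add_comm]
    exact (blockingNumber_union_le _ _).trans (Nat.add_le_add (h i (Finset.mem_insert_self i s))
      (ih fun j hj => h j (Finset.mem_insert_of_mem hj)))

lemma exists_subpath_blockingNumber_eq [Finite V] {k : ℕ} (hk : 0 < k) {u v : V}
    (p : G.Walk u v) (hp : p.IsPath) (h : k ≤ blockingNumber G F {x | x ∈ p.support}) :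
    ∃ a b : V, ∃ q : G.Walk a b, q.IsPath ∧ q.support ⊆ p.support ∧
      blockingNumber G F {x | x ∈ q.support} = k := by
  induction p with
  | @nil u =>
    refine ⟨u, u, .nil, hp, fun _ hx => hx, h.antisymm' ?_⟩
    simpa using (blockingNumber_singleton_le u).trans hk
  | @cons u w v hadj p ih =>
    by_cases h' : k ≤ blockingNumber G F {x | x ∈ p.support}
    · obtain ⟨a, b, q, hq, hqp, hqk⟩ := ih hp.of_cons h'
      exact ⟨a, b, q, hq, fun x hx => List.mem_cons_of_mem _ (hqp hx), hqk⟩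
    · refine ⟨u, v, .cons hadj p, hp, fun _ hx => hx, h.antisymm' ?_⟩
      have hcons : {x | x ∈ (Walk.cons hadj p).support} = {u} ∪ {x | x ∈ p.support} := by
        ext x
        simp
      have hunion := blockingNumber_union_le (G := G) (F := F) {u} {x | x ∈ p.support}
      have hu := blockingNumber_singleton_le (G := G) (F := F) u
      rw [hcons]
      lia

/-- A strict bramble: a family of vertex sets that induce connected subgraphs and pairwise
intersect. -/
structure IsStrictBramble (G : SimpleGraph V) (F : Set (Set V)) : Prop where
  preconnected : ∀ Q ∈ F, (G.induce Q).Preconnected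
  intersecting : ∀ Q ∈ F, ∀ R ∈ F, (Q ∩ R).Nonempty

lemma exists_walk_of_preconnected_induce (hQ : (G.induce Q).Preconnected) (u v : Q) :
    ∃ p : G.Walk u v, ∀ x ∈ p.support, x ∈ Q := by
  obtain ⟨p⟩ := hQ u v
  refine ⟨p.map (Embedding.induce Q).toHom, fun x hx => ?_⟩
  obtain ⟨y, -, rfl⟩ := List.mem_map.1 (Walk.support_map _ p ▸ hx)
  exact y.2

namespace IsStrictBramble

lemma nonempty (hF : IsStrictBramble G F) (hQ : Q ∈ F) : Q.Nonempty := by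
  simpa using hF.intersecting Q hQ Q hQ

lemma subset_reach (hF : IsStrictBramble G F) {S : Finset V}
    (hA : S.card < blockingNumber G F A) : ∃ Q ∈ F, Q ⊆ reach G A S := by
  have hS : ¬ Blocks G F S A := fun h => hA.not_ge (blockingNumber_le_card h)
  unfold Blocks at hS
  push Not at hS
  obtain ⟨Q, hQ, hQS, hsep⟩ := hS
  unfold Separates at hsep
  push Not at hsep
  obtain ⟨a, ha, q, hq, p, hp⟩ := hsep
  refine ⟨Q, hQ, fun w hw => ?_⟩
  obtain ⟨r, hr⟩ := exists_walk_of_preconnected_induce (hF.preconnected Q hQ) ⟨q, hq⟩ ⟨w, hw⟩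
  exact mem_reach_of_walk ⟨a, ha, p, hp⟩ r fun v hv => Set.disjoint_left.1 hQS (hr v hv)

lemma not_separates (hF : IsStrictBramble G F) {S : Finset V}
    (hA : S.card < blockingNumber G F A) (hD : S.card < blockingNumber G F D) :
    ¬ Separates G A D S := by
  intro hsep
  obtain ⟨Q, hQ, hQA⟩ := hF.subset_reach hA
  obtain ⟨R, hR, hRD⟩ := hF.subset_reach hD
  obtain ⟨w, hwQ, hwR⟩ := hF.intersecting Q hQ R hR
  exact Set.disjoint_left.1 hsep.disjoint_reach (hQA hwQ) (hRD hwR)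

lemma nonempty_linkage [Finite V] (hF : IsStrictBramble G F) {k : ℕ}
    (hA : k ≤ blockingNumber G F A) (hD : k ≤ blockingNumber G F D) :
    Nonempty (Linkage G A D (Fin k)) :=
  menger G A D fun S hS => by
    by_contra! hlt
    exact hF.not_separates (hlt.trans_le hA) (hlt.trans_le hD) hS

lemma lt_blockingNumber [Finite V] (hF : IsStrictBramble G F) {n : ℕ}
    (hn : ∀ S : Finset V, S.card ≤ n → ∃ Q ∈ F, Disjoint Q (S : Set V)) (hP : P ∈ F) :
    n < blockingNumber G F P := by
  by_contra! hle
  obtain ⟨X, hX, hXc⟩ := exists_blocks_card_eq (G := G) (F := F) P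
  obtain ⟨Q, hQ, hQX⟩ := hn X (hXc ▸ hle)
  exact Set.not_disjoint_iff_nonempty_inter.2 (hF.intersecting P hP Q hQ) (hX.disjoint hQ hQX)

end IsStrictBramble

lemma Linkage.exists_truncation {ι : Type*} (L : Linkage G A D ι) (hX : Separates G A D X) :
    ∃ L' : Linkage G A X ι, L'.src = L.src := by
  choose x hx q hq hqL hqX using fun i =>
    exists_prefix_path (L.walk i) (hX _ (L.src_mem i) _ (L.tgt_mem i) (L.walk i))
  exact ⟨⟨L.src, x, q, L.src_mem, hx, hq, fun i v hv => L.eq_src i v (hqL i hv), hqX,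
    fun i j v hi hj => L.disj i j v (hqL i hi) (hqL j hj)⟩, rfl⟩

/-- The linkage is cut off at `X`, and Menger's theorem continues it from `X` to `R`. -/
lemma IsStrictBramble.exists_disjoint_walks [Finite V] (hF : IsStrictBramble G F) {k : ℕ}
    {X : Finset V} (hX : Blocks G F X A) (hXk : X.card = k) (hA : k ≤ blockingNumber G F A)
    (L : Linkage G A D (Fin k)) (hD : Separates G A D X) (hR : R ∈ F)
    (hRX : Disjoint R (X : Set V)) (hRk : k ≤ blockingNumber G F R) :
    ∃ (b : Fin k → V) (p : ∀ i, G.Walk (L.src i) (b i)), (∀ i, b i ∈ R) ∧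
      ∀ i j v, v ∈ (p i).support → v ∈ (p j).support → i = j := by
  obtain ⟨L', hL'⟩ := L.exists_truncation hD
  obtain ⟨L₂⟩ := hF.nonempty_linkage (hA.trans hX.blockingNumber_le) hRk
  choose σ hσ using fun i => L₂.exists_src_eq (by simp [hXk]) (L'.tgt_mem i)
  have hσ_inj : Function.Injective σ := fun i j hij =>
    L'.tgt_injective (by rw [← hσ i, ← hσ j, hij])
  obtain ⟨p, hp⟩ := Linkage.exists_disjoint_walks (hX R hR hRX) subset_rfl subset_rfl L' L₂
    le_rfl hσ_inj fun i => Or.inl (hσ i).symm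
  rw [← hL']
  exact ⟨_, p, fun i => L₂.tgt_mem _, hp⟩

end Bramble

section Cycle

variable {V ι : Type*} {G : SimpleGraph V} {F : Set (Set V)} {A D T X : Set V} {a b u v w : V}

lemma isPath_append_iff {p : G.Walk u v} {q : G.Walk v w} :
    (p.append q).IsPath ↔
      p.IsPath ∧ q.IsPath ∧ ∀ x ∈ p.support, x ∈ q.support → x = v := by
  rw [Walk.isPath_def, Walk.isPath_def, Walk.isPath_def, Walk.support_append, List.nodup_append',
    ← q.cons_tail_support, List.nodup_cons, List.tail_cons]
  refine ⟨fun ⟨hp, hq, hd⟩ => ⟨hp, ⟨fun hv => hd p.end_mem_support hv, hq⟩, fun x hx hxq => ?_⟩,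
    fun ⟨hp, ⟨hv, hq⟩, h⟩ => ⟨hp, hq, fun x hx hxq => ?_⟩⟩
  · exact (List.mem_cons.1 hxq).resolve_right (hd hx)
  · exact hv (h x hx (List.mem_cons_of_mem _ hxq) ▸ hxq)

lemma notMem_support_tail {p : G.Walk u v} (hp : p.IsPath) : u ∉ p.support.tail := by
  have h := hp.support_nodup
  rw [← p.cons_tail_support, List.nodup_cons] at h
  exact h.1

lemma isCycle_append_of_meet_ends {p : G.Walk u v} {q : G.Walk v u} (hp : p.IsPath)
    (hq : q.IsPath) (h : ∀ x ∈ p.support, x ∈ q.support → x = u ∨ x = v)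
    (hl : 1 < p.length ∨ 1 < q.length) : (p.append q).IsCycle := by
  refine hp.isCycle_append hq (fun x hxp hxq => ?_) hl
  rcases h x (List.mem_of_mem_tail hxp) (List.mem_of_mem_tail hxq) with rfl | rfl
  exacts [notMem_support_tail hp hxp, notMem_support_tail hq hxq]

lemma exists_suffix_path {p : G.Walk u v} (hp : p.IsPath) (hT : T ⊆ {x | x ∈ p.support})
    (hne : T.Nonempty) : ∃ a ∈ T, ∃ q : G.Walk a v,
      q.IsPath ∧ q.support ⊆ p.support ∧ T ⊆ {x | x ∈ q.support} := by
  obtain ⟨a, ha, p₁, p₂, rfl, hfirst⟩ := exists_append_first_mem p (hne.imp fun t ht => ⟨hT ht, ht⟩)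
  refine ⟨a, ha, p₂, hp.of_append_right,
    fun x hx => Walk.support_subset_support_append_right _ _ hx, fun t ht => ?_⟩
  rcases (Walk.mem_support_append_iff _ _).1 (hT ht) with h | h
  · rw [hfirst t h ht]
    exact p₂.start_mem_support
  · exact h

lemma exists_spanning_subpath {p : G.Walk u v} (hp : p.IsPath) (hT : T ⊆ {x | x ∈ p.support})
    (hne : T.Nonempty) : ∃ a ∈ T, ∃ b ∈ T, ∃ q : G.Walk a b,
      q.IsPath ∧ q.support ⊆ p.support ∧ T ⊆ {x | x ∈ q.support} := by
  obtain ⟨a, ha, q, hq, hqp, hTq⟩ := exists_suffix_path hp hT hne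
  obtain ⟨b, hb, r, hr, hrq, hTr⟩ := exists_suffix_path hq.reverse (by simpa using hTq) hne
  refine ⟨a, ha, b, hb, r.reverse, hr.reverse, fun x hx => hqp ?_, by simpa using hTr⟩
  simpa using hrq (by simpa using hx)

lemma exists_path_in_support (p : G.Walk u v) (ha : a ∈ p.support) (hb : b ∈ p.support) :
    ∃ q : G.Walk a b, q.IsPath ∧ q.support ⊆ p.support := by
  classical
  refine ⟨((p.takeUntil a ha).reverse.append (p.takeUntil b hb)).bypass,
    Walk.bypass_isPath _, fun x hx => ?_⟩
  have hx' := Walk.support_bypass_subset_support _ hx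
  rw [Walk.mem_support_append_iff, Walk.support_reverse, List.mem_reverse] at hx'
  exact hx'.elim (p.support_takeUntil_subset_support ha ·) (p.support_takeUntil_subset_support hb ·)

namespace Linkage

lemma length_pos (L : Linkage G A D ι) (hAD : Disjoint A D) (i : ι) : 0 < (L.walk i).length := by
  by_contra! h
  have hi := Walk.eq_of_length_eq_zero (Nat.le_zero.1 h)
  exact Set.disjoint_left.1 hAD (L.src_mem i) (hi ▸ L.tgt_mem i)

lemma isCycle (L : Linkage G A D ι) (hAD : Disjoint A D) {i j : ι} (hij : i ≠ j)
    {p : G.Walk (L.src i) (L.src j)} (hp : p.IsPath) (hpA : ∀ x ∈ p.support, x ∈ A)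
    {q : G.Walk (L.tgt j) (L.tgt i)} (hq : q.IsPath) (hqD : ∀ x ∈ q.support, x ∈ D) :
    ((p.append (L.walk j)).append (q.append (L.walk i).reverse)).IsCycle := by
  have hpj : (p.append (L.walk j)).IsPath :=
    isPath_append_iff.2 ⟨hp, L.isPath j, fun x hx hxj => L.eq_src j x hxj (hpA x hx)⟩
  have hqi : (q.append (L.walk i).reverse).IsPath :=
    isPath_append_iff.2 ⟨hq, (L.isPath i).reverse,
      fun x hx hxi => L.eq_tgt i x (by simpa using hxi) (hqD x hx)⟩
  refine isCycle_append_of_meet_ends hpj hqi (fun x hx hx' => ?_) (.inl ?_)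
  · simp only [Walk.mem_support_append_iff, Walk.support_reverse, List.mem_reverse] at hx hx'
    rcases hx with hx | hx <;> rcases hx' with hx' | hx'
    · exact (Set.disjoint_left.1 hAD (hpA x hx) (hqD x hx')).elim
    · exact .inl (L.eq_src i x hx' (hpA x hx))
    · exact .inr (L.eq_tgt j x hx (hqD x hx'))
    · exact (hij (L.disj i j x hx' hx)).elim
  · have hp_pos : 0 < p.length := by
      by_contra! h
      exact hij (L.src_injective (Walk.eq_of_length_eq_zero (Nat.le_zero.1 h)))
    have hj_pos := L.length_pos hAD j
    rw [Walk.length_append]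
    lia

lemma exists_cycle {p : G.Walk a b} (hp : p.IsPath) {q : G.Walk u v}
    (L : Linkage G {x | x ∈ p.support} {x | x ∈ q.support} ι)
    (hpq : Disjoint {x | x ∈ p.support} {x | x ∈ q.support}) {K : Finset ι} (hK : 1 < K.card) :
    ∃ i ∈ K, ∃ j ∈ K, ∃ w, ∃ c : G.Walk w w, c.IsCycle ∧ (∀ k ∈ K, L.src k ∈ c.support) ∧
      ∀ x ∈ c.support, x ∈ p.support ∨ x ∈ q.support ∨
        x ∈ (L.walk i).support ∨ x ∈ (L.walk j).support := by
  have hKne : (K : Set ι).Nonempty := Finset.card_pos.1 (by lia)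
  obtain ⟨_, ⟨i, hi, rfl⟩, _, ⟨j, hj, rfl⟩, p', hp', hp'p, hKp'⟩ :=
    exists_spanning_subpath hp (T := L.src '' K) (Set.image_subset_iff.2 fun k _ => L.src_mem k)
      (hKne.image _)
  obtain ⟨q', hq', hq'q⟩ := exists_path_in_support q (L.tgt_mem j) (L.tgt_mem i)
  have hij : i ≠ j := by
    rintro rfl
    obtain ⟨k, hk, hki⟩ := Finset.exists_mem_ne hK i
    have hk' : L.src k ∈ p'.support := hKp' ⟨k, hk, rfl⟩
    rw [Walk.isPath_iff_nil.1 hp' |>.eq_nil, Walk.support_nil, List.mem_singleton] at hk'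
    exact hki (L.src_injective hk')
  refine ⟨i, hi, j, hj, _, _, L.isCycle hpq hij hp' (fun _ hx => hp'p hx) hq' fun _ hx => hq'q hx,
    fun k hk => ?_, fun x hx => ?_⟩
  · rw [Walk.mem_support_append_iff, Walk.mem_support_append_iff]
    exact .inl (.inl (hKp' ⟨k, hk, rfl⟩))
  · simp only [Walk.mem_support_append_iff, Walk.support_reverse, List.mem_reverse] at hx
    rcases hx with (hx | hx) | hx | hx
    exacts [.inl (hp'p hx), .inr (.inr (.inr hx)), .inr (.inl (hq'q hx)), .inr (.inr (.inl hx))]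

lemma sum_length_support_le [Fintype V] (L : Linkage G A D ι) (K : Finset ι) :
    ∑ k ∈ K, (L.walk k).support.length ≤ Fintype.card V := by
  classical
  calc ∑ k ∈ K, (L.walk k).support.length
      = ∑ k ∈ K, (L.walk k).support.toFinset.card :=
        Finset.sum_congr rfl fun k _ =>
          (List.toFinset_card_of_nodup (L.isPath k).support_nodup).symm
    _ = (K.biUnion fun k => (L.walk k).support.toFinset).card :=
        (Finset.card_biUnion fun i _ j _ hij => Finset.disjoint_left.2 fun x hi hj =>
          hij (L.disj i j x (List.mem_toFinset.1 hi) (List.mem_toFinset.1 hj))).symm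
    _ ≤ Fintype.card V := Finset.card_le_univ _

lemma exists_short [Fintype V] [Fintype ι] (L : Linkage G A D ι) {s : ℕ}
    (hs : Fintype.card V < s * s) :
    ∃ K : Finset ι, Fintype.card ι < K.card + s ∧
      ∀ k ∈ K, (L.walk k).support.length ≤ s := by
  classical
  let K : Finset ι := {k | (L.walk k).support.length ≤ s}
  refine ⟨K, ?_, fun k hk => (Finset.mem_filter.1 hk).2⟩
  have hlong : Kᶜ.card * s ≤ Fintype.card V :=
    (Finset.card_nsmul_le_sum Kᶜ (fun k => (L.walk k).support.length) s fun k hk =>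
      (lt_of_not_ge (by simpa [K] using hk)).le).trans (L.sum_length_support_le _)
  have hcompl : Kᶜ.card < s := lt_of_mul_lt_mul_right (hlong.trans_lt hs) s.zero_le
  have := K.card_add_card_compl
  lia

end Linkage

lemma exists_subpath_blocks_card_eq [Finite V] {k : ℕ} (hk : 0 < k) {p : G.Walk u v}
    (hp : p.IsPath) (h : k ≤ blockingNumber G F {x | x ∈ p.support}) :
    ∃ a b : V, ∃ q : G.Walk a b, ∃ X : Finset V, q.IsPath ∧ q.support ⊆ p.support ∧
      k ≤ blockingNumber G F {x | x ∈ q.support} ∧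
      Blocks G F X {x | x ∈ q.support} ∧ X.card = k := by
  obtain ⟨a, b, q, hq, hqp, hqk⟩ := exists_subpath_blockingNumber_eq hk p hp h
  obtain ⟨X, hX, hXc⟩ := exists_blocks_card_eq (G := G) (F := F) {x | x ∈ q.support}
  exact ⟨a, b, q, X, hq, hqp, hqk.ge, hX, hXc.trans hqk⟩

/-- Two disjoint paths that are hard to block are joined by many disjoint paths, and two short ones
among these close up to the cycle. -/
lemma IsStrictBramble.exists_cycle_linkage [Fintype V] (hF : IsStrictBramble G F)
    (hne : F.Nonempty) {s z : ℕ} (hz : 0 < z) (hs : Fintype.card V < s * s)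
    (hT : ∀ S : Finset V, S.card ≤ 2 * (s + z) + 2 * s → ∃ Q ∈ F, Disjoint Q (S : Set V))
    (hpath : ∀ Q ∈ F, ∃ a b : V, ∃ p : G.Walk a b, p.IsPath ∧ (∀ x ∈ p.support, x ∈ Q) ∧
      s + z ≤ blockingNumber G F {x | x ∈ p.support}) :
    ∃ R ∈ F, ∃ w : V, ∃ c : G.Walk w w, c.IsCycle ∧ (∀ x ∈ c.support, x ∉ R) ∧
      Nonempty (Linkage G {x | x ∈ c.support} R (Fin z)) := by
  classical
  obtain ⟨P, hP⟩ := hne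
  obtain ⟨_, _, p, hp, -, hpk⟩ := hpath P hP
  obtain ⟨_, _, pA, X, hpA, -, hAk, hX, hXk⟩ := exists_subpath_blocks_card_eq (by lia) hp hpk
  obtain ⟨Q, hQ, hQX⟩ := hT X (by lia)
  obtain ⟨_, _, q, hq, hqQ, hqk⟩ := hpath Q hQ
  obtain ⟨_, _, pD, Y, -, hDq, hDk, hY, hYk⟩ := exists_subpath_blocks_card_eq (by lia) hq hqk
  have hDQ : {x | x ∈ pD.support} ⊆ Q := fun x hx => hqQ x (hDq hx)
  have hAD := (hX.disjoint hQ hQX).mono_right hDQ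
  obtain ⟨L⟩ := hF.nonempty_linkage hAk hDk
  obtain ⟨K, hKz, hK⟩ := L.exists_short hs
  rw [Fintype.card_fin] at hKz
  obtain ⟨i, hi, j, hj, w, c, hc, hKc, hcsub⟩ := L.exists_cycle hpA hAD (K := K) (by lia)
  obtain ⟨R, hR, hRd⟩ :=
    hT (X ∪ Y ∪ ((L.walk i).support.toFinset ∪ (L.walk j).support.toFinset)) <| by
      grw [Finset.card_union_le, Finset.card_union_le, Finset.card_union_le,
        List.toFinset_card_le, List.toFinset_card_le, hK i hi, hK j hj]
      lia
  simp only [Finset.coe_union, Set.disjoint_union_right, List.coe_toFinset] at hRd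
  obtain ⟨⟨hRX, hRY⟩, hRi, hRj⟩ := hRd
  refine ⟨R, hR, w, c, hc, fun x hx hxR => ?_, ?_⟩
  · rcases hcsub x hx with h | h | h | h
    · exact Set.disjoint_left.1 (hX.disjoint hR hRX) h hxR
    · exact Set.disjoint_left.1 (hY.disjoint hR hRY) h hxR
    · exact Set.disjoint_left.1 hRi hxR h
    · exact Set.disjoint_left.1 hRj hxR h
  · obtain ⟨b, r, hb, hr⟩ := hF.exists_disjoint_walks hX hXk hAk L
      (fun a ha d hd => hX Q hQ hQX a ha d (hDQ hd)) hR hRX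
      ((by lia : s + z ≤ 2 * (s + z) + 2 * s).trans (hF.lt_blockingNumber hT hR).le)
    obtain ⟨K', hK'K, hK'z⟩ := Finset.exists_subset_card_eq (show z ≤ K.card by lia)
    let e : Fin z → Fin (s + z) := fun k => (K'.equivFinOfCardEq hK'z).symm k
    have he : Function.Injective e := Subtype.val_injective.comp (Equiv.injective _)
    exact MSub.nonempty_linkage (fun k => r (e k)) (fun k => hKc _ (hK'K (Subtype.prop _)))
      (fun k => hb _) fun k l x hk hl => he (hr _ _ x hk hl)

end Cycle

section Gap

variable {V E ι : Type*} {G : SimpleGraph V} {R : Set V} {a b u v w : V}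

lemma exists_long_arc {c : G.Walk w w} (hc : c.IsCycle) (ha : a ∈ c.support)
    (hb : b ∈ c.support) (hab : a ≠ b) :
    ∃ q : G.Walk a b, q.IsPath ∧ q.support ⊆ c.support ∧ c.length ≤ 2 * q.length := by
  classical
  have hb' : b ∈ (c.rotate a ha).support := (Walk.mem_support_rotate_iff ..).2 hb
  obtain ⟨p, q, hpq⟩ : ∃ p q, c.rotate a ha = Walk.append (v := b) p q :=
    ⟨_, _, (Walk.take_spec _ hb').symm⟩
  have hcycle : (p.append q).IsCycle := hpq ▸ hc.rotate ha
  have hsub : (p.append q).support ⊆ c.support := fun x hx =>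
    (Walk.mem_support_rotate_iff ..).1 (hpq ▸ hx)
  have hlen : p.length + q.length = c.length := by
    rw [← Walk.length_append, ← hpq, Walk.length_rotate]
  by_cases h : c.length ≤ 2 * p.length
  · exact ⟨p, hcycle.isPath_of_append_left (Walk.not_nil_of_ne hab.symm),
      fun x hx => hsub (Walk.support_subset_support_append_left _ _ hx), h⟩
  · refine ⟨q.reverse, (hcycle.isPath_of_append_right (Walk.not_nil_of_ne hab)).reverse,
      fun x hx => hsub (Walk.support_subset_support_append_right _ _ (by simpa using hx)), ?_⟩
    rw [Walk.length_reverse]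
    lia

lemma Linkage.exists_long_detour {c : G.Walk w w} (hc : c.IsCycle)
    (hcR : Disjoint {x | x ∈ c.support} R) (L : Linkage G {x | x ∈ c.support} R ι)
    {i j : ι} (hij : i ≠ j) :
    ∃ q : G.Walk (L.tgt i) (L.tgt j), q.IsPath ∧
      (∀ x ∈ q.support, x ∈ R → x = L.tgt i ∨ x = L.tgt j) ∧ c.length + 4 ≤ 2 * q.length := by
  obtain ⟨q, hq, hqc, hqlen⟩ := exists_long_arc hc (L.src_mem i) (L.src_mem j)
    (L.src_injective.ne hij)
  have hqj : (q.append (L.walk j)).IsPath :=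
    isPath_append_iff.2 ⟨hq, L.isPath j, fun x hx hx' => L.eq_src j x hx' (hqc hx)⟩
  refine ⟨(L.walk i).reverse.append (q.append (L.walk j)),
    isPath_append_iff.2 ⟨(L.isPath i).reverse, hqj, fun x hx hx' => ?_⟩, fun x hx hxR => ?_, ?_⟩
  · rw [Walk.support_reverse, List.mem_reverse] at hx
    rcases (Walk.mem_support_append_iff _ _).1 hx' with hx' | hx'
    · exact L.eq_src i x hx (hqc hx')
    · exact (hij (L.disj i j x hx hx')).elim
  · simp only [Walk.mem_support_append_iff, Walk.support_reverse, List.mem_reverse] at hx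
    rcases hx with hx | hx | hx
    · exact .inl (L.eq_tgt i x hx hxR)
    · exact (Set.disjoint_left.1 hcR (hqc hx) hxR).elim
    · exact .inr (L.eq_tgt j x hx hxR)
  · have hi := L.length_pos hcR i
    have hj := L.length_pos hcR j
    simp only [Walk.length_append, Walk.length_reverse]
    lia

lemma card_mul_le_of_separated {T : Finset V} {f : V → ℕ} {n g : ℕ} (hf : ∀ t ∈ T, f t ≤ n)
    (hg : ∀ a ∈ T, ∀ b ∈ T, a ≠ b → f a ≤ f b → f a + g ≤ f b) : T.card * g ≤ n + g := by
  have hdisj : ∀ a ∈ T, ∀ b ∈ T, a ≠ b →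
      Disjoint (Finset.Ico (f a) (f a + g)) (Finset.Ico (f b) (f b + g)) := by
    intro a ha b hb hab
    rw [Finset.disjoint_left]
    intro x hxa hxb
    rw [Finset.mem_Ico] at hxa hxb
    rcases le_total (f a) (f b) with h | h
    · have := hg a ha b hb hab h
      lia
    · have := hg b hb a ha hab.symm h
      lia
  calc T.card * g = ∑ t ∈ T, (Finset.Ico (f t) (f t + g)).card := by simp
    _ = (T.biUnion fun t => Finset.Ico (f t) (f t + g)).card := (Finset.card_biUnion hdisj).symm
    _ ≤ (Finset.range (n + g)).card := Finset.card_le_card <| Finset.biUnion_subset.2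
        fun t ht x hx => Finset.mem_range.2 <| (Finset.mem_Ico.1 hx).2.trans_le <|
          Nat.add_le_add_right (hf t ht) g
    _ = n + g := Finset.card_range _

lemma card_mul_le_length {p : G.Walk u v} {T : Finset V} (hT : ∀ t ∈ T, t ∈ p.support) {g : ℕ}
    (h : ∀ a ∈ T, ∀ b ∈ T, a ≠ b → ∀ (p₁ : G.Walk u a) (p₂ : G.Walk a b) (p₃ : G.Walk b v),
      p = p₁.append (p₂.append p₃) → g ≤ p₂.length) :
    T.card * g ≤ p.length + g := by
  classical
  refine card_mul_le_of_separated
    (f := fun t => if ht : t ∈ p.support then (p.takeUntil t ht).length else 0)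
    (fun t ht => ?_) fun a ha b hb hab hle => ?_
  · simpa only [dif_pos (hT t ht)] using Walk.length_takeUntil_le_length _ _
  · simp only [dif_pos (hT a ha), dif_pos (hT b hb)] at hle ⊢
    have hab_mem : a ∈ (p.takeUntil b (hT b hb)).support := by
      rw [Walk.mem_support_iff_exists_getVert]
      refine ⟨(p.takeUntil a (hT a ha)).length, ?_, hle⟩
      rw [Walk.getVert_takeUntil _ hle, Walk.getVert_length_takeUntil]
    have hgap := h a ha b hb hab ((p.takeUntil b (hT b hb)).takeUntil a hab_mem)
      ((p.takeUntil b (hT b hb)).dropUntil a hab_mem) (p.dropUntil b (hT b hb)) (by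
        rw [Walk.append_assoc, Walk.take_spec, Walk.take_spec])
    have hlen := congrArg Walk.length ((p.takeUntil b (hT b hb)).take_spec hab_mem)
    rw [Walk.length_append, Walk.takeUntil_takeUntil] at hlen
    lia

/-- A set `R` of vertices covered by few walks such that replacing a segment of one of them by a
path that is internally disjoint from `R` never makes it longer. The bound on the total length holds
if the walks are internally disjoint. -/
structure TightRouteSystem [Fintype V] (G : SimpleGraph V) (E : Type*) [Fintype E]
    (R : Set V) where
  /-- The first end of each walk. -/
  src : E → V
  /-- The last end of each walk. -/
  tgt : E → V
  /-- The walks. -/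
  route : ∀ e, G.Walk (src e) (tgt e)
  mem_iff : ∀ x, x ∈ R ↔ ∃ e, x ∈ (route e).support
  exists_path : ∀ e, ∃ (a b : V) (p : G.Walk a b), p.IsPath ∧
    ∀ x, x ∈ p.support ↔ x ∈ (route e).support
  detour_le : ∀ e a b, a ≠ b → ∀ (p₁ : G.Walk (src e) a) (p₂ : G.Walk a b)
    (p₃ : G.Walk b (tgt e)), route e = p₁.append (p₂.append p₃) →
    ∀ q : G.Walk a b, q.IsPath → 2 ≤ q.length →
      (∀ x ∈ q.support, x ∈ R → x = a ∨ x = b) → q.length ≤ p₂.length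
  sum_length_le : ∑ e, (route e).length ≤ Fintype.card V + Fintype.card E

lemma Linkage.le_length {c : G.Walk w w} (hc : c.IsCycle) {z : ℕ}
    (L : Linkage G {x | x ∈ c.support} R (Fin z)) : z ≤ c.length := by
  classical
  have hsrc : ∀ i, L.src i ∈ c.support.tail.toFinset := fun i => by
    rw [List.mem_toFinset]
    rcases c.mem_support_iff.1 (L.src_mem i) with h | h
    · rw [h]
      exact c.end_mem_tail_support hc.not_nil
    · exact h
  calc z = (Finset.univ.image L.src).card := by
        rw [Finset.card_image_of_injective _ L.src_injective, Finset.card_fin]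
    _ ≤ c.support.tail.toFinset.card :=
        Finset.card_le_card (Finset.image_subset_iff.2 fun i _ => hsrc i)
    _ ≤ c.support.tail.length := List.toFinset_card_le _
    _ = c.length := by rw [List.length_tail, Walk.length_support, Nat.add_sub_cancel]

/-- A cycle with many links to `R` is long, and two links and an arc of the cycle form a long
detour, so that the ends of the links are far apart on each route. -/
lemma TightRouteSystem.mul_le [Fintype V] [Fintype E] (𝓡 : TightRouteSystem G E R)
    {c : G.Walk w w} (hc : c.IsCycle) (hcR : Disjoint {x | x ∈ c.support} R) {z g : ℕ}
    (L : Linkage G {x | x ∈ c.support} R (Fin z)) (hg : 2 * g ≤ z + 4) :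
    z * g ≤ Fintype.card V + Fintype.card E + Fintype.card E * g := by
  classical
  choose r hr using fun i => (𝓡.mem_iff _).1 (L.tgt_mem i)
  have hz := L.le_length hc
  have hroute : ∀ e, ({i | r i = e} : Finset (Fin z)).card * g ≤ (𝓡.route e).length + g := by
    intro e
    rw [← Finset.card_image_of_injective _ L.tgt_injective]
    refine card_mul_le_length ?_ ?_
    · simp only [Finset.mem_image, Finset.mem_filter_univ]
      rintro _ ⟨i, rfl, rfl⟩
      exact hr i
    · simp only [Finset.mem_image, Finset.mem_filter_univ]
      rintro _ ⟨i, -, rfl⟩ _ ⟨j, -, rfl⟩ hij p₁ p₂ p₃ hp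
      obtain ⟨q, hq, hqR, hqlen⟩ := L.exists_long_detour hc hcR (ne_of_apply_ne L.tgt hij)
      have hc3 := hc.three_le_length
      have hq_le := 𝓡.detour_le e _ _ hij p₁ p₂ p₃ hp q hq (by lia) hqR
      lia
  have hfibers := Finset.card_eq_sum_card_fiberwise (f := r) (s := Finset.univ) (t := Finset.univ)
    fun _ _ => Finset.mem_coe.2 (Finset.mem_univ _)
  calc z * g = ∑ e, ({i | r i = e} : Finset (Fin z)).card * g := by
        rw [← Finset.sum_mul, ← hfibers, Finset.card_fin]
    _ ≤ ∑ e, ((𝓡.route e).length + g) := Finset.sum_le_sum fun e _ => hroute e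
    _ = ∑ e, (𝓡.route e).length + Fintype.card E * g := by
        rw [Finset.sum_add_distrib, Finset.sum_const, Finset.card_univ, smul_eq_mul]
    _ ≤ Fintype.card V + Fintype.card E + Fintype.card E * g :=
        Nat.add_le_add_right 𝓡.sum_length_le _

end Gap

section Detour

variable {V : Type*} {G : SimpleGraph V} {a b u v : V}

lemma isPath_replace {p₁ : G.Walk u a} {p₂ q : G.Walk a b} {p₃ : G.Walk b v}
    (h : (p₁.append (p₂.append p₃)).IsPath) (hab : a ≠ b) (hq : q.IsPath)
    (hd : ∀ x ∈ q.support, x ∈ (p₁.append (p₂.append p₃)).support → x = a ∨ x = b) :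
    (p₁.append (q.append p₃)).IsPath := by
  simp only [Walk.mem_support_append_iff] at hd
  simp only [isPath_append_iff, Walk.mem_support_append_iff] at h ⊢
  obtain ⟨hp₁, ⟨-, hp₃, h₂₃⟩, h₁⟩ := h
  refine ⟨hp₁, ⟨hq, hp₃, fun x hxq hx => ?_⟩, fun x hx hx' => ?_⟩
  · refine (hd x hxq (.inr (.inr hx))).resolve_left ?_
    rintro rfl
    exact hab (h₂₃ x p₂.start_mem_support hx)
  · rcases hx' with hxq | hx₃
    · refine (hd x hxq (.inl hx)).resolve_right ?_
      rintro rfl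
      exact hab (h₁ x hx (.inl p₂.end_mem_support)).symm
    · exact h₁ x hx (.inr hx₃)

lemma isCycle_append_comm {p : G.Walk u v} {q : G.Walk v u} (h : (p.append q).IsCycle) :
    (q.append p).IsCycle := by
  have hlen := h.three_le_length
  rw [Walk.length_append, add_comm, ← Walk.length_append] at hlen
  rw [Walk.isCycle_def, Walk.isTrail_def, Walk.edges_append, Walk.tail_support_append] at h ⊢
  refine ⟨List.perm_append_comm.nodup h.1, fun hnil => ?_, List.perm_append_comm.nodup h.2.2⟩
  rw [hnil, Walk.length_nil] at hlen
  lia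

lemma isCycle_replace {p₁ : G.Walk u a} {p₂ q : G.Walk a b} {p₃ : G.Walk b v} (h : v = u)
    (hc : ((p₁.append (p₂.append p₃)).copy rfl h).IsCycle) (hab : a ≠ b) (hq : q.IsPath)
    (hlen : 2 ≤ q.length)
    (hd : ∀ x ∈ q.support, x ∈ (p₁.append (p₂.append p₃)).support → x = a ∨ x = b) :
    ((p₁.append (q.append p₃)).copy rfl h).IsCycle := by
  subst h
  rw [Walk.copy_rfl_rfl] at hc ⊢
  replace hc := isCycle_append_comm hc
  rw [← Walk.append_assoc] at hc
  apply isCycle_append_comm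
  rw [← Walk.append_assoc]
  refine isCycle_append_of_meet_ends hq (hc.isPath_of_append_right (Walk.not_nil_of_ne hab))
    (fun x hxq hx => hd x hxq ?_) (.inl hlen)
  rw [Walk.mem_support_append_iff] at hx
  rw [Walk.mem_support_append_iff, Walk.mem_support_append_iff]
  tauto

lemma exists_notMem_of_mem_edges {W : Set V} {q : G.Walk a b} (hq : q.IsPath)
    (hlen : 2 ≤ q.length) (hd : ∀ x ∈ q.support, x ∈ W → x = a ∨ x = b) {e : Sym2 V}
    (he : e ∈ q.edges) : ∃ x ∈ e, x ∉ W := by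
  by_contra! hW
  have hmem : ∀ x ∈ e, x = a ∨ x = b := fun x hx =>
    hd x (Walk.mem_support_of_mem_edges he hx) (hW x hx)
  induction e with
  | _ x y =>
  have hxy := (q.adj_of_mem_edges he).ne
  have hends : s(x, y) = s(a, b) := by
    rcases hmem x (Sym2.mem_mk_left x y) with rfl | rfl <;>
      rcases hmem y (Sym2.mem_mk_right _ y) with rfl | rfl <;> simp_all [Sym2.eq_swap]
  have hone := hq.length_eq_one_of_mem_edges (hends ▸ he)
  lia

end Detour

section Numerics

variable {k n m h : ℕ}

/-- The bound of the theorem, for a graph with `n` vertices and a multigraph with `m` edges. -/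
noncomputable def transversalBound (n m : ℕ) : ℝ :=
  max (5 * (n : ℝ) ^ ((2 : ℝ) / 3)) (2 * (m : ℝ) ^ 2 * (n : ℝ) ^ ((1 : ℝ) / 3))

lemma rpow_third_sq (n : ℕ) : ((n : ℝ) ^ ((1 : ℝ) / 3)) ^ 2 = (n : ℝ) ^ ((2 : ℝ) / 3) := by
  rw [← Real.rpow_natCast, ← Real.rpow_mul (Nat.cast_nonneg n)]
  norm_num

lemma rpow_third_cube (n : ℕ) : ((n : ℝ) ^ ((1 : ℝ) / 3)) ^ 3 = n := by
  rw [← Real.rpow_natCast, ← Real.rpow_mul (Nat.cast_nonneg n)]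
  norm_num

lemma le_rpow_third_of_pow_three_le {x : ℝ} (h : x ^ 3 ≤ n) : x ≤ (n : ℝ) ^ ((1 : ℝ) / 3) :=
  le_of_pow_le_pow_left₀ three_ne_zero (by positivity) (by rwa [rpow_third_cube])

lemma natCast_le_five_mul_rpow (hkn : k ≤ n) (hk : k ≤ 125) :
    (k : ℝ) ≤ 5 * (n : ℝ) ^ ((2 : ℝ) / 3) := by
  have hk5 : (k : ℝ) ^ ((1 : ℝ) / 3) ≤ 5 := by
    refine le_of_pow_le_pow_left₀ three_ne_zero (by norm_num) ?_
    rw [rpow_third_cube]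
    exact (Nat.cast_le.2 hk).trans (by norm_num)
  calc (k : ℝ) = (k : ℝ) ^ ((1 : ℝ) / 3) * (k : ℝ) ^ ((2 : ℝ) / 3) := by
        rw [← rpow_third_sq, ← pow_succ', rpow_third_cube]
    _ ≤ 5 * (n : ℝ) ^ ((2 : ℝ) / 3) := by gcongr

lemma transversalBound_le_of_pow_six_le (h : m ^ 6 ≤ n) :
    transversalBound n m ≤ 5 * (n : ℝ) ^ ((2 : ℝ) / 3) := by
  refine max_le le_rfl ?_
  have hm : (m : ℝ) ^ 2 ≤ (n : ℝ) ^ ((1 : ℝ) / 3) :=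
    le_rpow_third_of_pow_three_le (by rw [← pow_mul]; exact_mod_cast h)
  rw [← rpow_third_sq]
  calc 2 * (m : ℝ) ^ 2 * (n : ℝ) ^ ((1 : ℝ) / 3)
      ≤ 2 * (n : ℝ) ^ ((1 : ℝ) / 3) * (n : ℝ) ^ ((1 : ℝ) / 3) := by gcongr
    _ ≤ 5 * ((n : ℝ) ^ ((1 : ℝ) / 3)) ^ 2 := by nlinarith [sq_nonneg ((n : ℝ) ^ ((1 : ℝ) / 3))]

/-- The maximum is at least the mean of the two terms, and hence at least `√10 * m * r ^ 3`. -/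
lemma mul_add_le_max {r m : ℝ} (hr0 : 0 ≤ r) (hr : 5 ≤ r ^ 2) (hm0 : 0 ≤ m) (hm : m ≤ r ^ 2) :
    m * (5 / 2 * r ^ 3 + 2 + m) ≤ max (5 * (r ^ 2) ^ 2) (2 * m ^ 2 * r ^ 2) := by
  have hr_lower : 2.2 ≤ r := by nlinarith
  have hcube : 2.2 * r ^ 2 ≤ r ^ 3 := by nlinarith [sq_nonneg r]
  calc m * (5 / 2 * r ^ 3 + 2 + m) ≤ m * (3.15 * r ^ 3) := by gcongr; linarith
    _ ≤ (5 * (r ^ 2) ^ 2 + 2 * m ^ 2 * r ^ 2) / 2 := by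
        nlinarith [sq_nonneg (r * (m - 1.575 * r)), sq_nonneg (r ^ 2)]
    _ ≤ max (5 * (r ^ 2) ^ 2) (2 * m ^ 2 * r ^ 2) := by
        linarith [le_max_left (5 * (r ^ 2) ^ 2) (2 * m ^ 2 * r ^ 2),
          le_max_right (5 * (r ^ 2) ^ 2) (2 * m ^ 2 * r ^ 2)]

lemma exists_sixth_root (hn : 125 < n) (hmn : m ^ 3 < n) :
    ∃ r : ℝ, 0 ≤ r ∧ r ^ 2 = (n : ℝ) ^ ((1 : ℝ) / 3) ∧ 5 ≤ r ^ 2 ∧ m ≤ r ^ 2 ∧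
      n.sqrt ≤ r ^ 3 := by
  have hN : √((n : ℝ) ^ ((1 : ℝ) / 3)) ^ 2 = (n : ℝ) ^ ((1 : ℝ) / 3) :=
    Real.sq_sqrt (by positivity)
  refine ⟨√((n : ℝ) ^ ((1 : ℝ) / 3)), Real.sqrt_nonneg _, hN, ?_, ?_, ?_⟩
  · rw [hN]
    exact le_rpow_third_of_pow_three_le (by norm_num; exact_mod_cast hn.le)
  · rw [hN]
    exact le_rpow_third_of_pow_three_le (by exact_mod_cast hmn.le)
  · refine le_of_pow_le_pow_left₀ two_ne_zero (by positivity) ?_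
    rw [← pow_mul, mul_comm, pow_mul, hN, rpow_third_cube]
    exact_mod_cast Nat.sqrt_le' n

lemma blocking_le_transversalBound (hn : 125 < n) (hmn : m ^ 3 < n)
    (hh : 2 * h ≤ 3 * n.sqrt + 4) :
    ((2 * (n.sqrt + 1 + (h + m)) + 2 * (n.sqrt + 1) : ℕ) : ℝ) ≤ transversalBound n m := by
  obtain ⟨r, hr0, hrN, hr5, hmr, hnr⟩ := exists_sixth_root hn hmn
  have hh' : 2 * (h : ℝ) ≤ 3 * n.sqrt + 4 := mod_cast hh
  refine le_max_of_le_left ?_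
  rw [← rpow_third_sq, ← hrN]
  have hr_lower : 2.2 ≤ r := by nlinarith
  have hcube : 2.2 * r ^ 2 ≤ r ^ 3 := by nlinarith [sq_nonneg r]
  have hfourth : 2.2 * r ^ 3 ≤ (r ^ 2) ^ 2 := by nlinarith [pow_nonneg hr0 3]
  push_cast
  linarith

lemma mul_blocking_le_transversalBound (hn : 125 < n) (hmn : m ^ 3 < n)
    (hh : 2 * h ≤ 3 * n.sqrt + 4) :
    ((m * (n.sqrt + (h + m)) : ℕ) : ℝ) ≤ transversalBound n m := by
  obtain ⟨r, hr0, hrN, hr5, hmr, hnr⟩ := exists_sixth_root hn hmn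
  have hh' : 2 * (h : ℝ) ≤ 3 * n.sqrt + 4 := mod_cast hh
  rw [transversalBound, ← rpow_third_sq, ← hrN]
  refine le_trans ?_ (mul_add_le_max hr0 hr5 m.cast_nonneg hmr)
  rw [Nat.cast_mul]
  refine mul_le_mul_of_nonneg_left ?_ m.cast_nonneg
  push_cast
  linarith

lemma add_lt_mul_of_sqrt (hh : 3 * (n.sqrt + 1) ≤ 2 * h) :
    n + m < h * ((h + m + 4) / 2) := by
  have hn : n < (n.sqrt + 1) * (n.sqrt + 1) := n.lt_succ_sqrt
  have hsq := Nat.mul_le_mul hh hh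
  have hdiv : h + m + 3 ≤ 2 * ((h + m + 4) / 2) := by lia
  have hmul := Nat.mul_le_mul_left h hdiv
  have hm : 2 * m ≤ h * m := Nat.mul_le_mul_right m (by lia)
  nlinarith

end Numerics

section Transversal

variable {V E : Type*} [Fintype V] [Fintype E] {G : SimpleGraph V} {F : Set (Set V)}

lemma TightRouteSystem.exists_path_lt_blockingNumber {R : Set V} (𝓡 : TightRouteSystem G E R)
    {k : ℕ} (h : Fintype.card E * k < blockingNumber G F R) :
    ∃ a b : V, ∃ p : G.Walk a b, p.IsPath ∧ (∀ x ∈ p.support, x ∈ R) ∧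
      k < blockingNumber G F {x | x ∈ p.support} := by
  obtain ⟨e, he⟩ : ∃ e, k < blockingNumber G F {x | x ∈ (𝓡.route e).support} := by
    by_contra! hle
    have hR : R = ⋃ e ∈ Finset.univ, {x | x ∈ (𝓡.route e).support} := by
      ext x
      simp [𝓡.mem_iff]
    refine h.not_ge ?_
    rw [hR, ← Finset.card_univ]
    exact blockingNumber_biUnion_le _ fun e _ => hle e
  obtain ⟨a, b, p, hp, hpe⟩ := 𝓡.exists_path e
  refine ⟨a, b, p, hp, fun x hx => (𝓡.mem_iff x).2 ⟨e, (hpe x).1 hx⟩, ?_⟩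
  simpa only [hpe] using he

lemma IsStrictBramble.exists_card_le_transversal (hF : IsStrictBramble G F)
    (h𝓡 : ∀ Q ∈ F, Nonempty (TightRouteSystem G E Q)) {s z g n : ℕ}
    (hs : Fintype.card V < (s + 1) * (s + 1)) (hg : 2 * g ≤ z + 4)
    (hz : Fintype.card V + Fintype.card E + Fintype.card E * g < z * g)
    (hn₁ : 2 * (s + 1 + z) + 2 * (s + 1) ≤ n) (hn₂ : Fintype.card E * (s + z) ≤ n) :
    ∃ S : Finset V, S.card ≤ n ∧ ∀ Q ∈ F, ∃ v ∈ S, v ∈ Q := by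
  by_contra! hcon
  have hT : ∀ S : Finset V, S.card ≤ n → ∃ Q ∈ F, Disjoint Q (S : Set V) := fun S hS => by
    obtain ⟨Q, hQ, hQS⟩ := hcon S hS
    exact ⟨Q, hQ, Set.disjoint_right.2 hQS⟩
  obtain ⟨P, hP, -⟩ := hT ∅ n.zero_le
  obtain ⟨R, hR, w, c, hc, hcR, ⟨L⟩⟩ := hF.exists_cycle_linkage ⟨P, hP⟩
    (Nat.pos_of_mul_pos_right (Nat.zero_lt_of_lt hz)) hs (fun S hS => hT S (hS.trans hn₁)) <| by
      intro Q hQ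
      obtain ⟨𝓡⟩ := h𝓡 Q hQ
      obtain ⟨a, b, p, hp, hpQ, hpk⟩ := 𝓡.exists_path_lt_blockingNumber
        (hn₂.trans_lt (hF.lt_blockingNumber hT hQ))
      exact ⟨a, b, p, hp, hpQ, by lia⟩
  obtain ⟨𝓡⟩ := h𝓡 R hR
  exact hz.not_ge (𝓡.mul_le hc (Set.disjoint_left.2 hcR) L hg)

lemma exists_transversal_univ (hne : ∀ Q ∈ F, Q.Nonempty) (hV : Fintype.card V ≤ 125) :
    ∃ S : Finset V, (S.card : ℝ) ≤ 5 * (Fintype.card V : ℝ) ^ ((2 : ℝ) / 3) ∧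
      ∀ Q ∈ F, ∃ v ∈ S, v ∈ Q :=
  ⟨Finset.univ, natCast_le_five_mul_rpow le_rfl hV,
    fun Q hQ => (hne Q hQ).imp fun v hv => ⟨Finset.mem_univ v, hv⟩⟩

lemma IsStrictBramble.exists_transversal (hF : IsStrictBramble G F)
    (h𝓡 : ∀ Q ∈ F, Nonempty (TightRouteSystem G E Q))
    (hE : Fintype.card E ^ 3 < Fintype.card V) :
    ∃ S : Finset V, (S.card : ℝ) ≤ transversalBound (Fintype.card V) (Fintype.card E) ∧
      ∀ Q ∈ F, ∃ v ∈ S, v ∈ Q := by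
  by_cases hV : Fintype.card V ≤ 125
  · obtain ⟨S, hS, hSF⟩ := exists_transversal_univ (fun Q => hF.nonempty) hV
    exact ⟨S, hS.trans (le_max_left _ _), hSF⟩
  rw [not_le] at hV
  set s := (Fintype.card V).sqrt
  set m := Fintype.card E
  set h := (3 * s + 4) / 2
  obtain ⟨S, hS, hSF⟩ := hF.exists_card_le_transversal h𝓡 (s := s) (z := h + m)
    (g := (h + m + 4) / 2) (Nat.lt_succ_sqrt _) (by lia)
    (by rw [add_mul]; exact Nat.add_lt_add_right (add_lt_mul_of_sqrt (by lia)) _)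
    (Nat.le_floor (blocking_le_transversalBound hV hE (by lia)))
    (Nat.le_floor (mul_blocking_le_transversalBound hV hE (by lia)))
  exact ⟨S, (Nat.le_floor_iff (le_max_of_le_left (by positivity))).1 hS, hSF⟩

lemma IsStrictBramble.exists_transversal_of_pow_six_le (hF : IsStrictBramble G F)
    (h𝓡 : ∀ Q ∈ F, Nonempty (TightRouteSystem G E Q))
    (hE : Fintype.card E ^ 6 ≤ Fintype.card V) :
    ∃ S : Finset V, (S.card : ℝ) ≤ 5 * (Fintype.card V : ℝ) ^ ((2 : ℝ) / 3) ∧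
      ∀ Q ∈ F, ∃ v ∈ S, v ∈ Q := by
  by_cases hV : Fintype.card V ≤ 125
  · exact exists_transversal_univ (fun Q => hF.nonempty) hV
  have hE3 : Fintype.card E ^ 3 < Fintype.card V := by
    by_contra! hle
    nlinarith
  obtain ⟨S, hS, hSF⟩ := hF.exists_transversal h𝓡 hE3
  exact ⟨S, hS.trans (transversalBound_le_of_pow_six_le hE), hSF⟩

end Transversal

section LongestPaths

variable {V : Type*} {G : SimpleGraph V}

/-- The vertex sets of the longest paths of `G`. -/
def longestPaths (G : SimpleGraph V) : Set (Set V) :=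
  {P | ∃ (u v : V) (p : G.Walk u v), p.IsPath ∧
    (∀ (u' v' : V) (q : G.Walk u' v'), q.IsPath → q.length ≤ p.length) ∧
    P = {x | x ∈ p.support}}

lemma exists_half_path {u v a : V} (p : G.Walk u v) (hp : p.IsPath) (ha : a ∈ p.support) :
    ∃ b : V, ∃ q : G.Walk b a, q.IsPath ∧ q.support ⊆ p.support ∧ p.length ≤ 2 * q.length := by
  classical
  have hlen : (p.takeUntil a ha).length + (p.dropUntil a ha).length = p.length := by
    rw [← Walk.length_append, Walk.take_spec]
  by_cases h : p.length ≤ 2 * (p.takeUntil a ha).length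
  · exact ⟨u, p.takeUntil a ha, hp.takeUntil ha, p.support_takeUntil_subset_support ha, h⟩
  · refine ⟨v, (p.dropUntil a ha).reverse, (hp.dropUntil ha).reverse, fun x hx => ?_, ?_⟩
    · rw [Walk.support_reverse, List.mem_reverse] at hx
      exact p.support_dropUntil_subset_support ha hx
    · rw [Walk.length_reverse]
      lia

lemma exists_longer_path_of_disjoint (hG : G.Preconnected) {u v u' v' : V} {p : G.Walk u v}
    {q : G.Walk u' v'} (hp : p.IsPath) (hq : q.IsPath) (hd : p.support.Disjoint q.support) :
    ∃ a b : V, ∃ r : G.Walk a b, r.IsPath ∧ p.length + q.length < 2 * r.length := by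
  obtain ⟨w⟩ := hG u u'
  obtain ⟨a, ha, b, hb, t, ht, -, htp, htq⟩ := exists_trimmed_path
    (A := {x | x ∈ p.support}) (B := {x | x ∈ q.support}) w
    ⟨u, w.start_mem_support, p.start_mem_support⟩ q.start_mem_support
  obtain ⟨a', p', hp', hpp', hlp⟩ := exists_half_path p hp ha
  obtain ⟨b', q', hq', hqq', hlq⟩ := exists_half_path q hq hb
  have htq' : (t.append q'.reverse).IsPath :=
    isPath_append_iff.2 ⟨ht, hq'.reverse, fun x hx hx' => htq x hx (hqq' (by simpa using hx'))⟩
  have hr : (p'.append (t.append q'.reverse)).IsPath := by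
    refine isPath_append_iff.2 ⟨hp', htq', fun x hx hx' => ?_⟩
    rw [Walk.mem_support_append_iff, Walk.support_reverse, List.mem_reverse] at hx'
    exact hx'.elim (fun h => htp x h (hpp' hx)) fun h => (hd (hpp' hx) (hqq' h)).elim
  refine ⟨a', b', _, hr, ?_⟩
  have hab : t.length ≠ 0 := fun h => hd ha (Walk.eq_of_length_eq_zero h ▸ hb)
  simp only [Walk.length_append, Walk.length_reverse]
  lia

lemma isStrictBramble_longestPaths (hG : G.Preconnected) :
    IsStrictBramble G (longestPaths G) where
  preconnected := by
    rintro _ ⟨u, v, p, -, -, rfl⟩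
    exact p.connected_induce_support.preconnected
  intersecting := by
    rintro _ ⟨u, v, p, hp, hpmax, rfl⟩ _ ⟨u', v', q, hq, hqmax, rfl⟩
    by_contra hcon
    obtain ⟨a, b, r, hr, hlt⟩ := exists_longer_path_of_disjoint hG hp hq
      fun x hx hx' => hcon ⟨x, hx, hx'⟩
    have hrp := hpmax a b r hr
    have hrq := hqmax a b r hr
    lia

lemma nonempty_tightRouteSystem_of_mem_longestPaths [Fintype V] {P : Set V}
    (hP : P ∈ longestPaths G) : Nonempty (TightRouteSystem G Unit P) := by
  obtain ⟨u, v, p, hp, hmax, rfl⟩ := hP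
  exact ⟨{
    src := fun _ => u
    tgt := fun _ => v
    route := fun _ => p
    mem_iff := by simp
    exists_path := fun _ => ⟨u, v, p, hp, fun _ => Iff.rfl⟩
    detour_le := by
      rintro - a b hab p₁ p₂ p₃ rfl q hq - hd
      have hle := hmax _ _ _ (isPath_replace hp hab hq hd)
      simp only [Walk.length_append] at hle
      lia
    sum_length_le := by simpa using hp.length_lt.le.trans (Nat.le_succ _) }⟩

lemma exists_transversal_longestPaths [Fintype V] (hG : G.Connected) :
    ∃ S : Finset V, (S.card : ℝ) ≤ 5 * (Fintype.card V : ℝ) ^ ((2 : ℝ) / 3) ∧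
      ∀ (u v : V) (p : G.Walk u v), p.IsPath →
        (∀ (u' v' : V) (q : G.Walk u' v'), q.IsPath → q.length ≤ p.length) →
        ∃ x ∈ S, x ∈ p.support := by
  have : Nonempty V := hG.nonempty
  have hV : Fintype.card Unit ^ 6 ≤ Fintype.card V := by
    simp [Nat.one_le_iff_ne_zero]
  obtain ⟨S, hS, hSP⟩ :=
    (isStrictBramble_longestPaths hG.preconnected).exists_transversal_of_pow_six_le
      (fun _ => nonempty_tightRouteSystem_of_mem_longestPaths) hV
  exact ⟨S, hS, fun u v p hp hmax => hSP _ ⟨u, v, p, hp, hmax, rfl⟩⟩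

end LongestPaths

section Subdivisions

variable {α β V : Type*} {M : Graph α β} {G : SimpleGraph V}

namespace IsConnected

lemma exists_isLink (hM : IsConnected M) (hE : M.edgeSet.Nonempty) {x : α}
    (hx : x ∈ M.vertexSet) : ∃ e y, M.IsLink e x y := by
  obtain ⟨e, he⟩ := hE
  obtain ⟨u, v, huv⟩ := M.exists_isLink_of_mem_edgeSet he
  rcases (hM.2 x hx u huv.left_mem).cases_head with rfl | ⟨y, ⟨f, hf⟩, -⟩
  · exact ⟨e, v, huv⟩
  · exact ⟨f, y, hf⟩

lemma vertexSet_subsingleton (hM : IsConnected M) (hE : M.edgeSet = ∅) :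
    M.vertexSet.Subsingleton := fun x hx y hy => by
  rcases (hM.2 x hx y hy).cases_head with rfl | ⟨z, ⟨f, hf⟩, -⟩
  · rfl
  · simpa [hE] using hf.edge_mem

end IsConnected

namespace Subdivision

variable (D : Subdivision M G)

lemma mem_verts {x : V} :
    x ∈ D.toSubgraph.verts ↔ x ∈ Set.range D.branch ∨ ∃ e, x ∈ (D.route e).support := by
  simp [toSubgraph, eq_comm]

lemma mem_edgeSet {s : Sym2 V} : s ∈ D.toSubgraph.edgeSet ↔ ∃ e, s ∈ (D.route e).edges := by
  induction s with
  | _ x y => simp [toSubgraph]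

lemma branch_mem_verts (x : M.vertexSet) : D.branch x ∈ D.toSubgraph.verts :=
  D.mem_verts.2 (.inl ⟨x, rfl⟩)

variable {D} in
lemma mem_verts_of_mem_route {e : M.edgeSet} {x : V} (hx : x ∈ (D.route e).support) :
    x ∈ D.toSubgraph.verts :=
  D.mem_verts.2 (.inr ⟨e, hx⟩)

lemma isTrail_route (e : M.edgeSet) : (D.route e).IsTrail := by
  by_cases h : D.tail e = D.head e
  · exact (Walk.isTrail_copy _ _ _).1 (D.isCycle_of_eq e h).isTrail
  · exact (D.isPath_of_ne e h).isTrail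

lemma ncard_edgeSet [Fintype M.edgeSet] :
    D.toSubgraph.edgeSet.ncard = ∑ e, (D.route e).length := by
  classical
  have hedges : D.toSubgraph.edgeSet =
      (Finset.univ.biUnion fun e => (D.route e).edges.toFinset : Finset (Sym2 V)) := by
    ext s
    simp [D.mem_edgeSet]
  rw [hedges, Set.ncard_coe_finset, Finset.card_biUnion fun e _ f _ hef => ?_]
  · refine Finset.sum_congr rfl fun e _ => ?_
    rw [List.toFinset_card_of_nodup (D.isTrail_route e).edges_nodup, Walk.length_edges]
  · exact List.disjoint_toFinset_iff_disjoint.2 (D.edges_disjoint e f hef)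

/-- The subdivision obtained by rerouting the edge `e₀` along the walk `w`, which may use old
vertices and old edges only where the old route of `e₀` did. -/
noncomputable def updateRoute [DecidableEq M.edgeSet] (e₀ : M.edgeSet)
    (w : G.Walk (D.branch (D.tail e₀)) (D.branch (D.head e₀)))
    (hpath : D.tail e₀ ≠ D.head e₀ → w.IsPath)
    (hcycle : ∀ h : D.tail e₀ = D.head e₀, (w.copy rfl (congrArg D.branch h.symm)).IsCycle)
    (hverts : ∀ x ∈ w.support, x ∈ D.toSubgraph.verts → x ∈ (D.route e₀).support)
    (hedges : ∀ f, f ≠ e₀ → w.edges.Disjoint (D.route f).edges) : Subdivision M G where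
  branch := D.branch
  branch_injective := D.branch_injective
  tail := D.tail
  head := D.head
  isLink := D.isLink
  route := Function.update D.route e₀ w
  isPath_of_ne := (Function.forall_update_iff D.route
    fun e r => D.tail e ≠ D.head e → r.IsPath).2 ⟨hpath, fun e _ => D.isPath_of_ne e⟩
  isCycle_of_eq := (Function.forall_update_iff D.route fun e r =>
    ∀ h : D.tail e = D.head e, (r.copy rfl (congrArg D.branch h.symm)).IsCycle).2
      ⟨hcycle, fun e _ => D.isCycle_of_eq e⟩
  branch_mem_route := (Function.forall_update_iff D.route fun e r =>
    ∀ x, D.branch x ∈ r.support → x = D.tail e ∨ x = D.head e).2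
      ⟨fun x hx => D.branch_mem_route e₀ x (hverts _ hx (D.branch_mem_verts x)),
        fun e _ => D.branch_mem_route e⟩
  route_inter_route := by
    have hold : ∀ e, ∀ x ∈ (Function.update D.route e₀ w e).support,
        x ∈ D.toSubgraph.verts → x ∈ (D.route e).support :=
      (Function.forall_update_iff D.route fun e r =>
        ∀ x ∈ r.support, x ∈ D.toSubgraph.verts → x ∈ (D.route e).support).2
          ⟨hverts, fun _ _ _ hx _ => hx⟩
    intro e f hef x hxe hxf
    have hx : x ∈ D.toSubgraph.verts := by
      by_cases he : e = e₀
      · rw [Function.update_of_ne (he ▸ hef.symm)] at hxf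
        exact mem_verts_of_mem_route hxf
      · rw [Function.update_of_ne he] at hxe
        exact mem_verts_of_mem_route hxe
    exact D.route_inter_route e f hef x (hold e x hxe hx) (hold f x hxf hx)
  edges_disjoint := by
    intro e f hef
    by_cases he : e = e₀
    · subst he
      rw [Function.update_self, Function.update_of_ne hef.symm]
      exact hedges f hef.symm
    · rw [Function.update_of_ne he]
      by_cases hf : f = e₀
      · subst hf
        rw [Function.update_self]
        exact (hedges e he).symm
      · rw [Function.update_of_ne hf]
        exact D.edges_disjoint e f hef

lemma exists_replace [Fintype M.edgeSet] {e₀ : M.edgeSet} {a b : V} (hab : a ≠ b)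
    {p₁ : G.Walk (D.branch (D.tail e₀)) a} {p₂ q : G.Walk a b}
    {p₃ : G.Walk b (D.branch (D.head e₀))} (heq : D.route e₀ = p₁.append (p₂.append p₃))
    (hq : q.IsPath) (hlen : 2 ≤ q.length)
    (hd : ∀ x ∈ q.support, x ∈ D.toSubgraph.verts → x = a ∨ x = b) :
    ∃ D' : Subdivision M G, ∑ e, (D'.route e).length + p₂.length =
      ∑ e, (D.route e).length + q.length := by
  classical
  have hd₀ : ∀ x ∈ q.support, x ∈ (p₁.append (p₂.append p₃)).support → x = a ∨ x = b :=
    fun x hx hx' => hd x hx (mem_verts_of_mem_route (heq ▸ hx'))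
  refine ⟨D.updateRoute e₀ (p₁.append (q.append p₃))
    (fun h => isPath_replace (heq ▸ D.isPath_of_ne e₀ h) hab hq hd₀)
    (fun h => isCycle_replace _ (by rw [← heq]; exact D.isCycle_of_eq e₀ h) hab hq hlen hd₀)
    (fun x hx hxD => ?_) (fun f hf s hs hsf => ?_), ?_⟩
  · rw [heq]
    simp only [Walk.mem_support_append_iff] at hx ⊢
    rcases hx with hx | hx | hx
    · exact .inl hx
    · rcases hd x hx hxD with rfl | rfl
      · exact .inl p₁.end_mem_support
      · exact .inr (.inr p₃.start_mem_support)
    · exact .inr (.inr hx)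
  · have hs₀ : s ∉ (D.route e₀).edges := fun h => D.edges_disjoint f e₀ hf hsf h
    simp only [heq, Walk.edges_append, List.mem_append, not_or] at hs hs₀
    obtain ⟨x, hxs, hxD⟩ := exists_notMem_of_mem_edges hq hlen hd
      ((hs.resolve_left hs₀.1).resolve_right hs₀.2.2)
    exact hxD (mem_verts_of_mem_route (Walk.mem_support_of_mem_edges hsf hxs))
  · have hlen' : ∀ e, (Function.update D.route e₀ (p₁.append (q.append p₃)) e).length =
        Function.update (fun f => (D.route f).length) e₀ (p₁.append (q.append p₃)).length e :=
      fun e => Function.apply_update (fun _ r => r.length) D.route e₀ _ e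
    simp only [updateRoute, hlen']
    rw [Finset.sum_update_of_mem (Finset.mem_univ e₀),
      ← Finset.add_sum_erase _ (fun e => (D.route e).length) (Finset.mem_univ e₀), heq]
    simp only [Walk.length_append, Finset.sdiff_singleton_eq_erase]
    lia

lemma nodup_support_tail_route (e : M.edgeSet) : (D.route e).support.tail.Nodup := by
  by_cases h : D.tail e = D.head e
  · simpa only [Walk.support_copy] using (D.isCycle_of_eq e h).support_nodup
  · exact (D.isPath_of_ne e h).support_nodup.tail

lemma eq_head_of_branch_mem_support_tail {e : M.edgeSet} {x : M.vertexSet}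
    (hx : D.branch x ∈ (D.route e).support.tail) : x = D.head e := by
  refine (D.branch_mem_route e x (List.mem_of_mem_tail hx)).elim ?_ id
  rintro rfl
  by_contra h
  exact notMem_support_tail (D.isPath_of_ne e h) hx

lemma sum_length_le [Fintype V] [Fintype M.edgeSet] :
    ∑ e, (D.route e).length ≤ Fintype.card V + Fintype.card M.edgeSet := by
  classical
  let inner : M.edgeSet → Finset V := fun e =>
    (D.route e).support.tail.toFinset.erase (D.branch (D.head e))
  have hlen : ∀ e, (D.route e).length ≤ (inner e).card + 1 := fun e => by
    have hcard : (D.route e).support.tail.toFinset.card = (D.route e).length := by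
      rw [List.toFinset_card_of_nodup (D.nodup_support_tail_route e), List.length_tail,
        Walk.length_support, Nat.add_sub_cancel]
    exact hcard ▸ Nat.sub_le_iff_le_add.1 Finset.pred_card_le_card_erase
  have hdisj : ((Finset.univ : Finset M.edgeSet) : Set M.edgeSet).PairwiseDisjoint inner := by
    refine fun e _ f _ hef => Finset.disjoint_left.2 fun x hxe hxf => ?_
    simp only [inner, Finset.mem_erase, List.mem_toFinset] at hxe hxf
    obtain ⟨y, rfl⟩ := D.route_inter_route e f hef x (List.mem_of_mem_tail hxe.2)
      (List.mem_of_mem_tail hxf.2)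
    exact hxe.1 (congrArg D.branch (D.eq_head_of_branch_mem_support_tail hxe.2))
  calc ∑ e, (D.route e).length
      ≤ ∑ e, ((inner e).card + 1) := Finset.sum_le_sum fun e _ => hlen e
    _ = (Finset.univ.biUnion inner).card + Fintype.card M.edgeSet := by
      rw [Finset.sum_add_distrib, Finset.card_biUnion hdisj, Finset.sum_const, smul_eq_mul,
        mul_one, Finset.card_univ]
    _ ≤ Fintype.card V + Fintype.card M.edgeSet := Nat.add_le_add_right (Finset.card_le_univ _) _

lemma exists_path_route (e : M.edgeSet) :
    ∃ (a b : V) (p : G.Walk a b), p.IsPath ∧ ∀ x, x ∈ p.support ↔ x ∈ (D.route e).support := by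
  by_cases h : D.tail e = D.head e
  · have hc := D.isCycle_of_eq e h
    refine ⟨_, _, _, hc.isPath_tail, fun x => ?_⟩
    rw [Walk.support_tail_of_not_nil _ hc.not_nil,
      ← Walk.support_copy (D.route e) rfl (congrArg D.branch h.symm)]
    refine ⟨List.mem_of_mem_tail, fun hx => ((Walk.mem_support_iff _).1 hx).elim ?_ id⟩
    rintro rfl
    exact Walk.end_mem_tail_support hc.not_nil
  · exact ⟨_, _, _, D.isPath_of_ne e h, fun x => Iff.rfl⟩

lemma exists_branch_mem_route {e : β} {x y : α} (h : M.IsLink e x y) :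
    ∃ e', D.branch ⟨x, h.left_mem⟩ ∈ (D.route e').support ∧
      D.branch ⟨y, h.right_mem⟩ ∈ (D.route e').support := by
  have htail := (D.route ⟨e, h.edge_mem⟩).start_mem_support
  have hhead := (D.route ⟨e, h.edge_mem⟩).end_mem_support
  refine ⟨⟨e, h.edge_mem⟩, ?_⟩
  rcases h.eq_and_eq_or_eq_and_eq (D.isLink ⟨e, h.edge_mem⟩) with ⟨hx, hy⟩ | ⟨hx, hy⟩
  · simp only [hx, hy]
    exact ⟨htail, hhead⟩
  · simp only [hx, hy]
    exact ⟨hhead, htail⟩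

lemma mem_verts_iff_exists_mem_route (hM : IsConnected M) (hE : M.edgeSet.Nonempty) (x : V) :
    x ∈ D.toSubgraph.verts ↔ ∃ e, x ∈ (D.route e).support := by
  refine ⟨fun hx => (D.mem_verts.1 hx).elim ?_ id, fun ⟨_, hx⟩ => mem_verts_of_mem_route hx⟩
  rintro ⟨y, rfl⟩
  obtain ⟨e, z, h⟩ := hM.exists_isLink hE y.2
  exact (D.exists_branch_mem_route h).imp fun _ he => he.1

lemma reachable_of_mem_route {e : M.edgeSet} {x y : V} (hx : x ∈ (D.route e).support)
    (hy : y ∈ (D.route e).support) :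
    (G.induce D.toSubgraph.verts).Reachable ⟨x, mem_verts_of_mem_route hx⟩
      ⟨y, mem_verts_of_mem_route hy⟩ :=
  ((D.route e).connected_induce_support.preconnected ⟨x, hx⟩ ⟨y, hy⟩).map
    (G.induceHomOfLE fun _ => mem_verts_of_mem_route).toHom

lemma reachable_branch (hM : IsConnected M) (x y : M.vertexSet) :
    (G.induce D.toSubgraph.verts).Reachable ⟨D.branch x, D.branch_mem_verts x⟩
      ⟨D.branch y, D.branch_mem_verts y⟩ := by
  obtain ⟨y, hy⟩ := y
  induction hM.2 x x.2 y hy with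
  | refl => exact .rfl
  | tail _ hyz ih =>
    obtain ⟨f, hf⟩ := hyz
    obtain ⟨e, hey, hez⟩ := D.exists_branch_mem_route hf
    exact (ih hf.left_mem).trans (D.reachable_of_mem_route hey hez)

lemma preconnected_induce_verts (hM : IsConnected M) :
    (G.induce D.toSubgraph.verts).Preconnected := by
  have hbranch : ∀ u : D.toSubgraph.verts, ∃ x, (G.induce D.toSubgraph.verts).Reachable
      ⟨D.branch x, D.branch_mem_verts x⟩ u := by
    rintro ⟨u, hu⟩
    rcases D.mem_verts.1 hu with ⟨x, rfl⟩ | ⟨e, he⟩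
    · exact ⟨x, .rfl⟩
    · exact ⟨D.tail e, D.reachable_of_mem_route (D.route e).start_mem_support he⟩
  intro u v
  obtain ⟨x, hx⟩ := hbranch u
  obtain ⟨y, hy⟩ := hbranch v
  exact hx.symm.trans ((D.reachable_branch hM x y).trans hy)

lemma verts_subsingleton (hM : IsConnected M) (hE : M.edgeSet = ∅) :
    D.toSubgraph.verts.Subsingleton := by
  have := (hM.vertexSet_subsingleton hE).coe_sort
  have := Set.isEmpty_coe_sort.2 hE
  intro u hu v hv
  obtain ⟨x, rfl⟩ := (D.mem_verts.1 hu).resolve_right fun ⟨e, _⟩ => isEmptyElim e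
  obtain ⟨y, rfl⟩ := (D.mem_verts.1 hv).resolve_right fun ⟨e, _⟩ => isEmptyElim e
  rw [Subsingleton.elim x y]

end Subdivision

lemma isStrictBramble_maxSubdivisions (hM : IsConnected M)
    (hL : PairwiseIntersecting (maxSubdivisions M G)) :
    IsStrictBramble G (Subgraph.verts '' maxSubdivisions M G) where
  preconnected := by
    rintro _ ⟨_, ⟨⟨D, rfl⟩, -⟩, rfl⟩
    exact D.preconnected_induce_verts hM
  intersecting := by
    rintro _ ⟨Q, hQ, rfl⟩ _ ⟨R, hR, rfl⟩
    exact hL Q hQ R hR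

lemma nonempty_tightRouteSystem_of_mem_maxSubdivisions [Fintype V] [Fintype M.edgeSet]
    (hM : IsConnected M) (hE : M.edgeSet.Nonempty) {Q : Set V}
    (hQ : Q ∈ Subgraph.verts '' maxSubdivisions M G) :
    Nonempty (TightRouteSystem G M.edgeSet Q) := by
  obtain ⟨_, ⟨⟨D, rfl⟩, hmax⟩, rfl⟩ := hQ
  exact ⟨{
    src := fun e => D.branch (D.tail e)
    tgt := fun e => D.branch (D.head e)
    route := D.route
    mem_iff := D.mem_verts_iff_exists_mem_route hM hE
    exists_path := D.exists_path_route
    detour_le := by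
      intro e a b hab p₁ p₂ p₃ heq q hq hlen hd
      obtain ⟨D', hD'⟩ := D.exists_replace hab heq hq hlen hd
      have hle := hmax _ ⟨D', rfl⟩
      rw [D.ncard_edgeSet, D'.ncard_edgeSet] at hle
      lia
    sum_length_le := D.sum_length_le }⟩

lemma tau_le_of_exists_transversal {r : ℝ} (h : ∃ S : Finset V, (S.card : ℝ) ≤ r ∧
    ∀ Q ∈ Subgraph.verts '' maxSubdivisions M G, ∃ v ∈ S, v ∈ Q) : (tau M G : ℝ) ≤ r := by
  obtain ⟨S, hS, hSQ⟩ := h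
  have hτ : tau M G ≤ S.card := Nat.sInf_le ⟨S, fun Q hQ => hSQ _ ⟨Q, hQ, rfl⟩, rfl⟩
  exact (Nat.cast_le.2 hτ).trans hS

lemma tau_le_of_edgeSet_eq_empty [Fintype V] (hM : IsConnected M) (hE : M.edgeSet = ∅)
    (hL : PairwiseIntersecting (maxSubdivisions M G)) :
    (tau M G : ℝ) ≤ 5 * (Fintype.card V : ℝ) ^ ((2 : ℝ) / 3) := by
  obtain ⟨S, hS, hSQ⟩ : ∃ S : Finset V, S.card ≤ 1 ∧
      ∀ Q ∈ Subgraph.verts '' maxSubdivisions M G, ∃ v ∈ S, v ∈ Q := by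
    rcases (maxSubdivisions M G).eq_empty_or_nonempty with h | ⟨_, hQ⟩
    · exact ⟨∅, zero_le_one, by simp [h]⟩
    obtain ⟨⟨D, rfl⟩, -⟩ := id hQ
    obtain ⟨v, hv, -⟩ := hL _ hQ _ hQ
    refine ⟨{v}, le_rfl, Set.forall_mem_image.2 fun R hR => ⟨v, Finset.mem_singleton_self v, ?_⟩⟩
    obtain ⟨u, hu, huR⟩ := hL _ hQ R hR
    exact D.verts_subsingleton hM hE hu hv ▸ huR
  exact tau_le_of_exists_transversal
    ⟨S, natCast_le_five_mul_rpow S.card_le_univ (by lia), hSQ⟩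

lemma tau_le_transversalBound [Fintype V] (hfin : M.edgeSet.Finite) (hM : IsConnected M)
    (hL : PairwiseIntersecting (maxSubdivisions M G))
    (hV : M.edgeSet.ncard ^ 3 < Fintype.card V) :
    (tau M G : ℝ) ≤ transversalBound (Fintype.card V) M.edgeSet.ncard := by
  rcases M.edgeSet.eq_empty_or_nonempty with hE | hE
  · exact le_max_of_le_left (tau_le_of_edgeSet_eq_empty hM hE hL)
  have := hfin.fintype
  rw [← Set.fintypeCard_eq_ncard] at hV ⊢
  exact tau_le_of_exists_transversal <| (isStrictBramble_maxSubdivisions hM hL).exists_transversal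
    (fun _ => nonempty_tightRouteSystem_of_mem_maxSubdivisions hM hE) hV

lemma tau_le_of_pow_six_le [Fintype V] (hfin : M.edgeSet.Finite) (hM : IsConnected M)
    (hL : PairwiseIntersecting (maxSubdivisions M G))
    (hV : M.edgeSet.ncard ^ 6 ≤ Fintype.card V) :
    (tau M G : ℝ) ≤ 5 * (Fintype.card V : ℝ) ^ ((2 : ℝ) / 3) := by
  rcases M.edgeSet.eq_empty_or_nonempty with hE | hE
  · exact tau_le_of_edgeSet_eq_empty hM hE hL
  have := hfin.fintype
  rw [← Set.fintypeCard_eq_ncard] at hV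
  exact tau_le_of_exists_transversal <|
    (isStrictBramble_maxSubdivisions hM hL).exists_transversal_of_pow_six_le
      (fun _ => nonempty_tightRouteSystem_of_mem_maxSubdivisions hM hE) hV

end Subdivisions

end MSub

theorem theorem2 {V : Type*} [Fintype V] (G : SimpleGraph V) :
    (∀ (α β : Type*) (M : Graph α β),
      M.vertexSet.Finite → M.edgeSet.Finite → MSub.IsConnected M →
      MSub.PairwiseIntersecting (MSub.maxSubdivisions M G) →
        (M.edgeSet.ncard ^ 3 < Fintype.card V →
          (MSub.tau M G : ℝ) ≤ max (5 * (Fintype.card V : ℝ) ^ ((2 : ℝ) / 3))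
            (2 * (M.edgeSet.ncard : ℝ) ^ 2 * (Fintype.card V : ℝ) ^ ((1 : ℝ) / 3))) ∧
        (M.edgeSet.ncard ^ 6 ≤ Fintype.card V →
          (MSub.tau M G : ℝ) ≤ 5 * (Fintype.card V : ℝ) ^ ((2 : ℝ) / 3))) ∧
    (G.Connected →
      ∃ S : Finset V, (S.card : ℝ) ≤ 5 * (Fintype.card V : ℝ) ^ ((2 : ℝ) / 3) ∧
        ∀ (u v : V) (p : G.Walk u v), p.IsPath →
          (∀ (u' v' : V) (q : G.Walk u' v'), q.IsPath → q.length ≤ p.length) →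
          ∃ x ∈ S, x ∈ p.support) :=
  ⟨fun _ _ _ _ hE hM hL =>
    ⟨MSub.tau_le_transversalBound hE hM hL, MSub.tau_le_of_pow_six_le hE hM hL⟩,
    MSub.exists_transversal_longestPaths⟩
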